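/- **Theorem 6.1.** Let $g=\bigoplus_{i\ge 1}g^i$ be a differential graded Lie algebra over $\mathbb C$, concentrated in strictly positive degrees, with differential $\delta$ and with finite-dimensional cohomology in each degree (for instance a positively graded model of $\Gamma(\mathfrak g^\cdot)$, where $\mathfrak g^\cdot$ is a soft dgla resolution of a sheaf of Lie algebras $\mathfrak g$ with $H^0(\mathfrak g)=0$ and finite-dimensional cohomology). *Notation.* For $m\ge 0$ let $J_m=\bigoplus_{i\le m}J^{(i)}$ be the Jacobi complex of $g$, truncated at tensor degree $\le m$ and augmented by $\mathbb C$ in degree $0$. It lives in degrees $\ge 0$, with $$J_m^0=\bigoplus_{i\le m}\mathrm{Sym}^i g^1,\qquad J_m^1=\bigoplus_{1\le i\le m}\mathrm{Sym}^{i-1}g^1\otimes g^2 .$$ For a differential graded $g$-module $G$, $L_m(G)$ is the complex with $p$-th term $\operatorname{coker}\big(\mathrm{Hom}(J_m^1,G^p)\to \mathrm{Hom}(J_m^0,G^p)\big)$, the map being the transpose of the differential of $J_m$. Concretely, $L_m(G)^p$ is the space of polynomial maps $g^1\to G^p$ modulo those of order $>m$ and those of the form $x\mapsto Q(x)\big(\delta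 x+\tfrac12[x,x]\big)$ with $Q:g^1\to\mathrm{Hom}(g^2,G^p)$ polynomial; the differential of $L_m(G)$ sends the class of $q$ to the class of $x\mapsto \delta(q(x))+x\cdot q(x)$. Put $$R_m=H^0(L_m(\mathbb C)),\qquad \Theta_m=H^1(L_m(g)).$$ $R_m$ is a $\mathbb C$-algebra under multiplication of polynomial functions, $\Theta_m$ is an $R_m$-module, there are restriction maps $R_{m+1}\to R_m$ and $\Theta_{m+1}\to\Theta_m$ (written $r\mapsto r'$ and $u\mapsto u'$), and $\hat R=\varprojlim R_m$, $\hat\Theta=\varprojlim\Theta_m$. For a polynomial vector field $u:g^1\to g^1$ and a polynomial map $p$ on $g^1$, let $D_up$ be the derivative of $p$ along $u$, that is, the contraction of the $g^1$-factor of $u$ with the $\mathrm{Hom}(J,\cdot)$-factor of $p$. The action pairing and the bracket pairing $$\Theta_m\times R_{m+1}\to R_m,\quad ([u],[f])\mapsto [D_uf],\qquad B_{m+1}:\Theta_{m+1}\times\Theta_{m+1}\to\Theta_m,\quad B_{m+1}([u],[v])=[D_uv-D_vu]$$ are well defined for all $m\ge 0$. *Claim.* (i) $B_{m+1}$ is bilinear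 and alternating. The action pairing gives $R_m$-linear maps $$A_m:\Theta_m\to \mathrm{Der}_{\mathbb C}(R_{m+1},R_m)\qquad(m\ge 0)$$ that are compatible with restriction: $(A_{m+1}(u)f)'=A_m(u')(f')$ for $u\in\Theta_{m+1}$ and $f\in R_{m+2}$. The maps $A_0:\Theta_0\to\mathrm{Der}_{\mathbb C}(R_1,R_0)$ and $A_1:\Theta_1\to\mathrm{Der}_{\mathbb C}(R_2,R_1)$ are always isomorphisms. (ii) For all $m\ge 0$, $u,v\in\Theta_{m+1}$ and $f\in R_{m+2}$, $$A_m(u')\big(A_{m+1}(v)f\big)-A_m(v')\big(A_{m+1}(u)f\big)=A_m\big(B_{m+1}(u,v)\big)(f').$$ (iii) The pairings $B_m$ induce a bilinear pairing $\hat B$ on $\hat\Theta$, given by $\hat B(u,v)_m=B_{m+1}(u_{m+1},v_{m+1})$, and $\hat B$ turns $\hat\Theta$ into a Lie algebra. The maps $A_m$ induce a homomorphism of Lie algebras $\hat A:\hat\Theta\to\mathrm{Der}_{\mathbb C}(\hat R)$, given by $(\hat A(u)f)_m=A_m(u_m)(f_{m+1})$. If $g$ has unobstructed deformations (for every surjection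 $S'\to S$ of finite-dimensional local $\mathbb C$-algebras, every $x\in\mathfrak m_S\otimes g^1$ with $\delta x+\frac12[x,x]=0$ lifts to such an element over $S'$), then $\hat A$ is an isomorphism of Lie algebras. -/

import Mathlib

universe u

/-! ## Polynomial maps between complex vector spaces -/

section Poly

variable {V W W₁ W₂ W₃ : Type*} [AddCommGroup V] [Module ℂ V] [AddCommGroup W] [Module ℂ W]
  [AddCommGroup W₁] [Module ℂ W₁] [AddCommGroup W₂] [Module ℂ W₂] [AddCommGroup W₃] [Module ℂ W₃]

/-- `p : V → W` is a homogeneous polynomial map of degree `n`: it is the restriction to the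
diagonal of an `n`-linear map. -/
def IsHomogPoly (n : ℕ) (p : V → W) : Prop :=
  ∃ F : MultilinearMap ℂ (fun _ : Fin n => V) W, ∀ x, p x = F (fun _ => x)

variable (V W) in
/-- The polynomial maps `V → W` all of whose homogeneous components have degree `≥ n`. -/
def polyGE (n : ℕ) : Submodule ℂ (V → W) :=
  Submodule.span ℂ {p | ∃ k, n ≤ k ∧ IsHomogPoly k p}

theorem IsHomogPoly.mem {n k : ℕ} {p : V → W} (h : IsHomogPoly k p) (hk : n ≤ k) :
    p ∈ polyGE V W n := Submodule.subset_span ⟨k, hk, h⟩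

theorem polyGE_anti {m n : ℕ} (h : m ≤ n) : polyGE V W n ≤ polyGE V W m :=
  Submodule.span_mono fun _ ⟨k, hk, hp⟩ => ⟨k, h.trans hk, hp⟩

theorem polyGE_const (w : W) : (fun _ : V => w) ∈ polyGE V W 0 :=
  IsHomogPoly.mem (k := 0) ⟨MultilinearMap.constOfIsEmpty ℂ _ w, fun _ => rfl⟩ le_rfl

theorem polyGE_linear (T : V →ₗ[ℂ] W) : (fun x : V => T x) ∈ polyGE V W 1 :=
  IsHomogPoly.mem (k := 1)
    ⟨MultilinearMap.ofSubsingleton ℂ V W (0 : Fin 1) T, fun _ => rfl⟩ le_rfl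

theorem polyGE_bilin (β : W₁ →ₗ[ℂ] W₂ →ₗ[ℂ] W₃) {a b : ℕ} {p : V → W₁} {q : V → W₂}
    (hp : p ∈ polyGE V W₁ a) (hq : q ∈ polyGE V W₂ b) :
    (fun x => β (p x) (q x)) ∈ polyGE V W₃ (a + b) := by
  induction hp using Submodule.span_induction with
  | mem p hp =>
    obtain ⟨k, hk, F, hF⟩ := hp
    induction hq using Submodule.span_induction with
    | mem q hq =>
      obtain ⟨l, hl, G, hG⟩ := hq
      refine IsHomogPoly.mem (k := k + l) ⟨((TensorProduct.lift β).compMultilinearMap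
        (MultilinearMap.domCoprod F G)).domDomCongr finSumFinEquiv, fun x => ?_⟩ (add_le_add hk hl)
      simp [hF, hG, MultilinearMap.domCoprod_apply]
    | zero => simp only [Pi.zero_apply, map_zero]; exact Submodule.zero_mem _
    | add x y _ _ hx hy => simp only [Pi.add_apply, map_add]; exact Submodule.add_mem _ hx hy
    | smul c x _ hx => simp only [Pi.smul_apply, map_smul]; exact Submodule.smul_mem _ c hx
  | zero => simp only [Pi.zero_apply, map_zero, LinearMap.zero_apply]; exact Submodule.zero_mem _
  | add x y _ _ hx hy =>
    simp only [Pi.add_apply, map_add, LinearMap.add_apply]; exact Submodule.add_mem _ hx hy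
  | smul c x _ hx =>
    simp only [Pi.smul_apply, map_smul, LinearMap.smul_apply]; exact Submodule.smul_mem _ c hx

theorem polyGE_bilin_zero (β : W₁ →ₗ[ℂ] W₂ →ₗ[ℂ] W₃) {p : V → W₁} {q : V → W₂}
    (hp : p ∈ polyGE V W₁ 0) (hq : q ∈ polyGE V W₂ 0) :
    (fun x => β (p x) (q x)) ∈ polyGE V W₃ 0 := by
  have h := polyGE_bilin β hp hq
  rwa [zero_add] at h

theorem polyGE_smul {b : ℕ} {f : V → ℂ} {q : V → W} (hf : f ∈ polyGE V ℂ 0)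
    (hq : q ∈ polyGE V W b) : (fun x => f x • q x) ∈ polyGE V W b := by
  have h := polyGE_bilin (LinearMap.lsmul ℂ W) hf hq
  rw [zero_add] at h
  exact h

theorem polyGE_comp (T : W₁ →ₗ[ℂ] W₂) {a : ℕ} {p : V → W₁} (hp : p ∈ polyGE V W₁ a) :
    (fun x => T (p x)) ∈ polyGE V W₂ a := by
  have := polyGE_bilin (V := V) (LinearMap.id (R := ℂ) (M := W₁ →ₗ[ℂ] W₂)) (polyGE_const T) hp
  simpa using this

/-- `w` is the derivative at `t = 0` of `t ↦ p (x + t v)`, tested against linear functionals. -/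
def HasDirDeriv (p : V → W) (x v : V) (w : W) : Prop :=
  ∀ ψ : Module.Dual ℂ W, HasDerivAt (fun t : ℂ => ψ (p (x + t • v))) (ψ w) 0

theorem HasDirDeriv.unique {p : V → W} {x v : V} {w w' : W} (h : HasDirDeriv p x v w)
    (h' : HasDirDeriv p x v w') : w = w' := by
  rw [← sub_eq_zero, ← Module.forall_dual_apply_eq_zero_iff ℂ]
  intro ψ
  rw [map_sub, sub_eq_zero]
  exact (h ψ).unique (h' ψ)

open Classical in
/-- The derivative of `p` at `x` in the direction `v`. -/
noncomputable def dirDeriv (p : V → W) (x v : V) : W :=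
  if h : ∃ w, HasDirDeriv p x v w then h.choose else 0

theorem HasDirDeriv.eq {p : V → W} {x v : V} {w : W} (h : HasDirDeriv p x v w) :
    dirDeriv p x v = w := by
  have h' : ∃ w, HasDirDeriv p x v w := ⟨w, h⟩
  rw [dirDeriv, dif_pos h']
  exact h'.choose_spec.unique h

theorem hasDerivAt_multilinear {n : ℕ} (F : MultilinearMap ℂ (fun _ : Fin n => V) ℂ)
    (x v : V) : HasDerivAt (fun t : ℂ => F (fun _ => x + t • v))
      (∑ i, F (Function.update (fun _ => x) i v)) 0 := by
  induction n with
  | zero =>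
    have : (fun t : ℂ => F (fun _ => x + t • v)) = fun _ => F 0 := by
      funext t; congr 1; exact Subsingleton.elim _ _
    rw [this]; simpa using hasDerivAt_const (0 : ℂ) (F 0)
  | succ n ih =>
    have e : ∀ (a b : V), (fun _ : Fin (n + 1) => b) = Fin.cons b (fun _ : Fin n => b) := by
      intro a b; funext i; refine Fin.cases ?_ ?_ i <;> simp
    have h1 := ih (F.curryLeft x)
    have h2 := ih (F.curryLeft v)
    have h3 := h1.fun_add ((hasDerivAt_id (0 : ℂ)).fun_mul h2)
    refine (congrArg₂ (fun f c => HasDerivAt f c (0 : ℂ)) ?_ ?_).mpr h3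
    · funext t
      rw [e x (x + t • v)]
      simp only [id, MultilinearMap.curryLeft_apply,
        MultilinearMap.cons_add, MultilinearMap.cons_smul, smul_eq_mul]
    · rw [Fin.sum_univ_succ, add_comm]
      simp only [MultilinearMap.curryLeft_apply, id, zero_smul, add_zero, one_mul, zero_mul]
      congr 1
      · refine Finset.sum_congr rfl fun i _ => ?_
        congr 1
        rw [Fin.cons_update, ← e x x]
      · congr 1
        rw [e x x, Fin.update_cons_zero]

/-- Every polynomial map has a derivative, which is again a polynomial map. -/
theorem exists_deriv {n : ℕ} {p : V → W} (hp : p ∈ polyGE V W n) :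
    ∃ D ∈ polyGE V (V →ₗ[ℂ] W) (n - 1), ∀ x v, HasDirDeriv p x v (D x v) := by
  induction hp using Submodule.span_induction with
  | mem p hp =>
    obtain ⟨k, hk, F, hF⟩ := hp
    cases k with
    | zero =>
      refine ⟨0, Submodule.zero_mem _, fun x v ψ => ?_⟩
      have : (fun t : ℂ => ψ (p (x + t • v))) = fun _ => ψ (F 0) := by
        funext t; rw [hF]; congr 2; exact Subsingleton.elim _ _
      rw [this]; simpa using hasDerivAt_const (0 : ℂ) (ψ (F 0))
    | succ k =>
      let G : Fin (k + 1) → MultilinearMap ℂ (fun _ : Fin k => V) (V →ₗ[ℂ] W) := fun i =>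
        (F.domDomCongr (Equiv.swap i (Fin.last k))).curryRight
      have hG : ∀ i x v, G i (fun _ => x) v = F (Function.update (fun _ => x) i v) := by
        intro i x v
        simp only [G, MultilinearMap.curryRight_apply, MultilinearMap.domDomCongr_apply]
        congr 1
        funext j
        by_cases hj : j = i
        · subst hj; simp
        · rw [Function.update_of_ne hj]
          have : Equiv.swap i (Fin.last k) j ≠ Fin.last k := by
            intro h
            apply hj
            have h2 := congrArg (Equiv.swap i (Fin.last k)) h
            simpa using h2
          obtain ⟨l, hl⟩ := Fin.exists_castSucc_eq.2 this
          rw [← hl]; simp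
      refine ⟨fun x => ∑ i, G i (fun _ => x), ?_, fun x v ψ => ?_⟩
      · have : (fun x => ∑ i, G i (fun _ => x)) = ∑ i, (fun x : V => G i (fun _ => x)) := by
          funext x; simp
        rw [this]
        refine Submodule.sum_mem _ fun i _ => ?_
        exact IsHomogPoly.mem (k := k) ⟨G i, fun _ => rfl⟩ (by omega)
      · have := hasDerivAt_multilinear (ψ.compMultilinearMap F) x v
        simpa [hF, hG, LinearMap.sum_apply, map_sum] using this
  | zero =>
    refine ⟨0, Submodule.zero_mem _, fun x v ψ => ?_⟩
    simpa using hasDerivAt_const (0 : ℂ) (0 : ℂ)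
  | add p q _ _ hp hq =>
    obtain ⟨D, hD, h⟩ := hp
    obtain ⟨E, hE, h'⟩ := hq
    refine ⟨D + E, Submodule.add_mem _ hD hE, fun x v ψ => ?_⟩
    simpa using (h x v ψ).fun_add (h' x v ψ)
  | smul c p _ hp =>
    obtain ⟨D, hD, h⟩ := hp
    refine ⟨c • D, Submodule.smul_mem _ c hD, fun x v ψ => ?_⟩
    simpa using (h x v ψ).const_mul c

/-- The derivative of the polynomial map `p` along the polynomial vector field `u` on `V`. -/
noncomputable def polyAct (u : V → V) (p : V → W) : V → W := fun x => dirDeriv p x (u x)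

theorem hasDirDeriv_polyAct (u : V → V) {p : V → W} (hp : p ∈ polyGE V W 0) (x : V) :
    HasDirDeriv p x (u x) (polyAct u p x) := by
  obtain ⟨D, -, h⟩ := exists_deriv hp
  rw [polyAct, (h x (u x)).eq]
  exact h x (u x)

theorem polyAct_mem {u : V → V} {p : V → W} {a n : ℕ} (hu : u ∈ polyGE V V a)
    (hp : p ∈ polyGE V W n) : polyAct u p ∈ polyGE V W (n - 1 + a) := by
  obtain ⟨D, hD, h⟩ := exists_deriv hp
  have : polyAct u p = fun x => D x (u x) := funext fun x => (h x (u x)).eq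
  rw [this]
  exact polyGE_bilin LinearMap.id hD hu

theorem polyAct_add (u : V → V) {p q : V → W} (hp : p ∈ polyGE V W 0) (hq : q ∈ polyGE V W 0) :
    polyAct u (p + q) = polyAct u p + polyAct u q := by
  funext x
  refine HasDirDeriv.eq fun ψ => ?_
  simpa using (hasDirDeriv_polyAct u hp x ψ).fun_add (hasDirDeriv_polyAct u hq x ψ)

theorem polyAct_sub (u : V → V) {p q : V → W} (hp : p ∈ polyGE V W 0) (hq : q ∈ polyGE V W 0) :
    polyAct u (p - q) = polyAct u p - polyAct u q := by
  funext x
  refine HasDirDeriv.eq fun ψ => ?_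
  simpa using (hasDirDeriv_polyAct u hp x ψ).fun_sub (hasDirDeriv_polyAct u hq x ψ)

theorem polyAct_sub_left (u u' : V → V) {p : V → W} (hp : p ∈ polyGE V W 0) :
    polyAct (u - u') p = polyAct u p - polyAct u' p := by
  obtain ⟨D, -, h⟩ := exists_deriv hp
  funext x
  simp [polyAct, (h _ _).eq]

theorem polyAct_linear (u : V → V) (T : V →ₗ[ℂ] W) :
    polyAct u (fun x => T x) = fun x => T (u x) := by
  funext x
  refine HasDirDeriv.eq fun ψ => ?_
  simpa using ((hasDerivAt_id (0 : ℂ)).mul_const (ψ (T (u x)))).const_add (ψ (T x))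

theorem polyAct_comp (T : W₁ →ₗ[ℂ] W₂) (u : V → V) {p : V → W₁} (hp : p ∈ polyGE V W₁ 0) :
    polyAct u (fun x => T (p x)) = fun x => T (polyAct u p x) := by
  funext x
  exact HasDirDeriv.eq fun ψ => hasDirDeriv_polyAct u hp x (ψ ∘ₗ T)

/-- Along a line, a polynomial map is a finite sum of vectors times powers of the parameter. -/
theorem poly_line {p : V → W} (hp : p ∈ polyGE V W 0) (x v : V) :
    (fun t : ℂ => p (x + t • v)) ∈
      Submodule.span ℂ {γ : ℂ → W | ∃ (k : ℕ) (w : W), γ = fun t => t ^ k • w} := by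
  set S := Submodule.span ℂ {γ : ℂ → W | ∃ (k : ℕ) (w : W), γ = fun t => t ^ k • w} with hS
  have hmul : ∀ γ ∈ S, (fun t : ℂ => t • γ t) ∈ S := by
    intro γ hγ
    induction hγ using Submodule.span_induction with
    | mem γ h =>
      obtain ⟨k, w, rfl⟩ := h
      exact Submodule.subset_span ⟨k + 1, w, by funext t; rw [pow_succ', mul_smul]⟩
    | zero => simp only [Pi.zero_apply, smul_zero]; exact Submodule.zero_mem _
    | add a b _ _ ha hb => simp only [Pi.add_apply, smul_add]; exact Submodule.add_mem _ ha hb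
    | smul c a _ ha =>
      simp only [Pi.smul_apply, smul_comm _ c]; exact Submodule.smul_mem _ c ha
  have key : ∀ (n : ℕ) (F : MultilinearMap ℂ (fun _ : Fin n => V) W),
      (fun t : ℂ => F (fun _ => x + t • v)) ∈ S := by
    intro n
    induction n with
    | zero =>
      intro F
      refine Submodule.subset_span ⟨0, F 0, ?_⟩
      funext t
      rw [pow_zero, one_smul]; congr 1; exact Subsingleton.elim _ _
    | succ n ih =>
      intro F
      have : (fun t : ℂ => F (fun _ => x + t • v)) =
          (fun t => F.curryLeft x (fun _ => x + t • v)) +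
          fun t => t • F.curryLeft v (fun _ => x + t • v) := by
        funext t
        have e : (fun _ : Fin (n + 1) => x + t • v) =
            Fin.cons (x + t • v) (fun _ : Fin n => x + t • v) := by
          funext i; refine Fin.cases ?_ ?_ i <;> simp
        rw [e]
        simp only [Pi.add_apply, MultilinearMap.curryLeft_apply, MultilinearMap.cons_add,
          MultilinearMap.cons_smul]
      rw [this]
      exact S.add_mem (ih _) (hmul _ (ih _))
  induction hp using Submodule.span_induction with
  | mem p h => obtain ⟨k, -, F, hF⟩ := h; simpa only [hF] using key k F
  | zero => exact S.zero_mem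
  | add a b _ _ ha hb => exact S.add_mem ha hb
  | smul c a _ ha => exact S.smul_mem c ha

theorem polyAct_bilin (β : W₁ →ₗ[ℂ] W₂ →ₗ[ℂ] W₃) (u : V → V) {p : V → W₁} {q : V → W₂}
    (hp : p ∈ polyGE V W₁ 0) (hq : q ∈ polyGE V W₂ 0) :
    polyAct u (fun x => β (p x) (q x)) =
      fun x => β (polyAct u p x) (q x) + β (p x) (polyAct u q x) := by
  funext x
  refine HasDirDeriv.eq ?_
  have h1 := hasDirDeriv_polyAct u hp x
  have h2 := hasDirDeriv_polyAct u hq x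
  set w₂ := polyAct u q x
  have key : ∃ w₁ : W₁, (∀ ψ : Module.Dual ℂ W₁,
        HasDerivAt (fun t : ℂ => ψ (p (x + t • u x))) (ψ w₁) 0) ∧
      ∀ ψ : Module.Dual ℂ W₃, HasDerivAt (fun t : ℂ => ψ (β (p (x + t • u x)) (q (x + t • u x))))
        (ψ (β w₁ (q x) + β (p (x + (0 : ℂ) • u x)) w₂)) 0 := by
    have := poly_line hp x (u x)
    revert this
    generalize hγ : (fun t : ℂ => p (x + t • u x)) = γ
    have hγ' : ∀ t, p (x + t • u x) = γ t := fun t => congrFun hγ t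
    simp only [hγ']
    clear hγ hγ' h1
    intro hγ
    induction hγ using Submodule.span_induction with
    | mem γ h =>
      obtain ⟨k, w, rfl⟩ := h
      refine ⟨((k : ℂ) * 0 ^ (k - 1)) • w, fun ψ => ?_, fun ψ => ?_⟩
      · simpa using (hasDerivAt_pow k (0 : ℂ)).mul_const (ψ w)
      · simpa using (hasDerivAt_pow k (0 : ℂ)).fun_mul (h2 (ψ ∘ₗ β w))
    | zero => exact ⟨0, fun ψ => by simpa using hasDerivAt_const (0 : ℂ) (0 : ℂ),
        fun ψ => by simpa using hasDerivAt_const (0 : ℂ) (0 : ℂ)⟩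
    | add a b _ _ ha hb =>
      obtain ⟨w, hw, hw'⟩ := ha
      obtain ⟨z, hz, hz'⟩ := hb
      refine ⟨w + z, fun ψ => by simpa using (hw ψ).fun_add (hz ψ), fun ψ => ?_⟩
      have := (hw' ψ).fun_add (hz' ψ)
      simp only [Pi.add_apply, map_add, LinearMap.add_apply] at this ⊢
      rwa [add_add_add_comm] at this
    | smul c a _ ha =>
      obtain ⟨w, hw, hw'⟩ := ha
      refine ⟨c • w, fun ψ => by simpa using (hw ψ).const_mul c, fun ψ => ?_⟩
      have := (hw' ψ).const_mul c
      simp only [Pi.smul_apply, map_smul, LinearMap.smul_apply, map_add, smul_eq_mul,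
        mul_add] at this ⊢
      exact this
  obtain ⟨w₁, hw₁, h⟩ := key
  have : w₁ = polyAct u p x := HasDirDeriv.unique hw₁ h1
  subst this
  simpa [HasDirDeriv] using h

end Poly
section PolyRing

variable (V W : Type*) [AddCommGroup V] [Module ℂ V] [AddCommGroup W] [Module ℂ W]

/-- The polynomial functions on `V`, as a subalgebra of the algebra of all functions. -/
def polySubalgebra : Subalgebra ℂ (V → ℂ) where
  carrier := polyGE V ℂ 0
  mul_mem' := fun ha hb => polyGE_smul ha hb
  add_mem' := Submodule.add_mem _
  algebraMap_mem' := fun c => polyGE_const c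

/-- The `ℂ`-algebra of polynomial functions on `V`. In characteristic `0` its homogeneous part of
degree `i` is the dual of `Sym^i V`, and the product is dual to the comultiplication. -/
def PolyRing : Type _ := ↥(polySubalgebra V)

theorem PolyRing.prop {V : Type*} [AddCommGroup V] [Module ℂ V] (f : PolyRing V) :
    f.1 ∈ polyGE V ℂ 0 := f.2

noncomputable instance : CommRing (PolyRing V) := inferInstanceAs (CommRing (polySubalgebra V))

noncomputable instance : Algebra ℂ (PolyRing V) := inferInstanceAs (Algebra ℂ (polySubalgebra V))

noncomputable instance : Module (PolyRing V) (V → W) :=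
  inferInstanceAs (Module (polySubalgebra V) (V → W))

instance : IsScalarTower ℂ (PolyRing V) (V → W) :=
  inferInstanceAs (IsScalarTower ℂ (polySubalgebra V) (V → W))

/-- The module of polynomial maps `V → W` over the algebra of polynomial functions on `V`; it is
the direct sum over `i` of the spaces `Hom (Sym^i V, W)`. -/
def polyMap : Submodule (PolyRing V) (V → W) where
  carrier := polyGE V W 0
  add_mem' := Submodule.add_mem _
  zero_mem' := Submodule.zero_mem _
  smul_mem' := fun c _ hx => polyGE_smul c.2 hx

end PolyRing

/-! ## Differential graded Lie algebras in positive degrees -/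

/-- A differential graded Lie algebra over `ℂ`, concentrated in strictly positive degrees;
`deg i` is the component of degree `i`. -/
structure PosDGLA (L : Type u) [AddCommGroup L] [Module ℂ L] where
  deg : ℕ → Submodule ℂ L
  isInternal : DirectSum.IsInternal deg
  deg_zero : deg 0 = ⊥
  bracket : L →ₗ[ℂ] L →ₗ[ℂ] L
  bracket_mem : ∀ {i j : ℕ} {a b : L}, a ∈ deg i → b ∈ deg j → bracket a b ∈ deg (i + j)
  bracket_skew : ∀ {i j : ℕ} {a b : L}, a ∈ deg i → b ∈ deg j →
    bracket a b = -((-1 : ℂ) ^ (i * j) • bracket b a)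
  jacobi : ∀ {i j k : ℕ} {a b c : L}, a ∈ deg i → b ∈ deg j → c ∈ deg k →
    bracket a (bracket b c) =
      bracket (bracket a b) c + (-1 : ℂ) ^ (i * j) • bracket b (bracket a c)
  diff : L →ₗ[ℂ] L
  diff_mem : ∀ {i : ℕ} {a : L}, a ∈ deg i → diff a ∈ deg (i + 1)
  diff_diff : ∀ a : L, diff (diff a) = 0
  leibniz : ∀ {i j : ℕ} {a b : L}, a ∈ deg i → b ∈ deg j →
    diff (bracket a b) = bracket (diff a) b + (-1 : ℂ) ^ i • bracket a (diff b)

namespace PosDGLA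

variable {L : Type u} [AddCommGroup L] [Module ℂ L] (g : PosDGLA L)

/-- The component of degree `p`. -/
abbrev Deg (p : ℕ) : Type u := ↥(g.deg p)

/-- The cohomology of the differential graded Lie algebra in degree `i`. -/
abbrev Coh (i : ℕ) : Type u :=
  ↥(g.deg i ⊓ LinearMap.ker g.diff) ⧸
    (g.deg i ⊓ LinearMap.range g.diff).comap (g.deg i ⊓ LinearMap.ker g.diff).subtype

/-- The differential `g^p → g^(p+1)`. -/
def d (p : ℕ) : g.Deg p →ₗ[ℂ] g.Deg (p + 1) := g.diff.restrict fun _ h => g.diff_mem h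

/-- The bracket `g^1 × g^p → g^(p+1)`. -/
def br (p : ℕ) : g.Deg 1 →ₗ[ℂ] g.Deg p →ₗ[ℂ] g.Deg (p + 1) :=
  LinearMap.mk₂ ℂ
    (fun x y => ⟨g.bracket x y, by rw [add_comm]; exact g.bracket_mem x.2 y.2⟩)
    (fun _ _ _ => Subtype.ext (by simp)) (fun _ _ _ => Subtype.ext (by simp))
    (fun _ _ _ => Subtype.ext (by simp)) (fun _ _ _ => Subtype.ext (by simp))

/-- The Maurer-Cartan map `g^1 → g^2`, `x ↦ δ x + [x, x] / 2`. -/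
noncomputable def curv (x : g.Deg 1) : g.Deg 2 := g.d 1 x + (1 / 2 : ℂ) • g.br 1 x x

/-! ### The Jacobi complex and the `L`-complexes

As `g` lives in degrees `≥ 1`, the Jacobi complex `J_m` lives in degrees `≥ 0`; with the summand
`ℂ` added in degree `0`, its terms of degree `0` and `1` are
`⊕_{i ≤ m} Sym^i g^1` and `⊕_{1 ≤ i ≤ m} Sym^(i-1) g^1 ⊗ g^2`, and its differential sends the
divided power exponential `e^x`, `x ∈ g^1`, to `e^x · (δ x + [x, x] / 2)` (terms of tensor degree
`≤ m`). Thus, for a vector space `W`, `Hom (J_m^0, W)` is the space of polynomial maps `g^1 → W`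
modulo those of order `> m`, the space `Hom (J_m^1, W)` consists of the polynomial maps
`Q : g^1 → Hom (g^2, W)` modulo those of order `> m - 1`, and the transposed differential
`Hom (J_m^1, W) → Hom (J_m^0, W)` is `Q ↦ (x ↦ Q x (δ x + [x, x] / 2))`. The space
`Hom (J, W)` plays the role of `*J ⊗ W`; the two agree if `J` is finite dimensional, and they have
the same vertical cokernel if `J` has finite-dimensional cohomology.
-/

/-- The transposed differential `Hom (J^1, W) → Hom (J^0, W)`. -/
noncomputable def transposeDiff (W : Type*) [AddCommGroup W] [Module ℂ W] :
    (g.Deg 1 → (g.Deg 2 →ₗ[ℂ] W)) →ₗ[ℂ] (g.Deg 1 → W) where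
  toFun Q := fun x => Q x (g.curv x)
  map_add' _ _ := rfl
  map_smul' _ _ := rfl

/-- The polynomial maps `g^1 → W` that vanish in the vertical cokernel
`Hom (J_m^0, W) / im Hom (J_m^1, W)`. -/
noncomputable def rel (m : ℕ) (W : Type*) [AddCommGroup W] [Module ℂ W] :
    Submodule ℂ (g.Deg 1 → W) :=
  polyGE (g.Deg 1) W (m + 1) ⊔
    (polyGE (g.Deg 1) (g.Deg 2 →ₗ[ℂ] W) 0).map (g.transposeDiff W)

section rel

variable {g} {W W₁ W₂ W₃ : Type*} [AddCommGroup W] [Module ℂ W] [AddCommGroup W₁] [Module ℂ W₁]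
  [AddCommGroup W₂] [Module ℂ W₂] [AddCommGroup W₃] [Module ℂ W₃]

theorem mem_rel {m : ℕ} {p : g.Deg 1 → W} : p ∈ g.rel m W ↔
    ∃ q ∈ polyGE (g.Deg 1) W (m + 1), ∃ Q ∈ polyGE (g.Deg 1) (g.Deg 2 →ₗ[ℂ] W) 0,
      p = q + fun x => Q x (g.curv x) := by
  rw [rel, Submodule.mem_sup]
  constructor
  · rintro ⟨q, hq, _, ⟨Q, hQ, rfl⟩, rfl⟩
    exact ⟨q, hq, Q, hQ, rfl⟩
  · rintro ⟨q, hq, Q, hQ, rfl⟩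
    exact ⟨q, hq, _, ⟨Q, hQ, rfl⟩, rfl⟩

theorem curv_poly : g.curv ∈ polyGE (g.Deg 1) (g.Deg 2) 0 := by
  refine Submodule.add_mem _ (polyGE_anti (Nat.zero_le _) (polyGE_linear (g.d 1))) ?_
  exact Submodule.smul_mem _ (1 / 2 : ℂ) (polyGE_anti (Nat.zero_le _) (polyGE_bilin (g.br 1)
    (polyGE_linear LinearMap.id) (polyGE_linear LinearMap.id)))

theorem rel_anti {m : ℕ} : g.rel (m + 1) W ≤ g.rel m W :=
  sup_le_sup_right (polyGE_anti (Nat.le_succ _)) _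

theorem rel_bilin (β : W₁ →ₗ[ℂ] W₂ →ₗ[ℂ] W₃) {m : ℕ} {p : g.Deg 1 → W₁} {q : g.Deg 1 → W₂}
    (hp : p ∈ polyGE (g.Deg 1) W₁ 0) (hq : q ∈ g.rel m W₂) :
    (fun x => β (p x) (q x)) ∈ g.rel m W₃ := by
  obtain ⟨e, he, Q, hQ, rfl⟩ := mem_rel.1 hq
  have h1 := polyGE_bilin β hp he
  rw [zero_add] at h1
  have h2 := polyGE_bilin_zero ((LinearMap.llcomp ℂ (g.Deg 2) W₂ W₃) ∘ₗ β) hp hQ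
  refine mem_rel.2 ⟨_, h1, _, h2, ?_⟩
  funext x
  simp only [Pi.add_apply, map_add, LinearMap.comp_apply, LinearMap.llcomp_apply]

theorem rel_comp (T : W₁ →ₗ[ℂ] W₂) {m : ℕ} {p : g.Deg 1 → W₁} (hp : p ∈ g.rel m W₁) :
    (fun x => T (p x)) ∈ g.rel m W₂ :=
  rel_bilin (LinearMap.id (R := ℂ) (M := W₁ →ₗ[ℂ] W₂)) (polyGE_const T) hp

theorem rel_smul {m : ℕ} {f : g.Deg 1 → ℂ} {q : g.Deg 1 → W}
    (hf : f ∈ polyGE (g.Deg 1) ℂ 0) (hq : q ∈ g.rel m W) :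
    (fun x => f x • q x) ∈ g.rel m W := by
  have h := rel_bilin (LinearMap.lsmul ℂ W) hf hq
  exact h

end rel

/-- The relations as a submodule of the module of polynomial maps. -/
noncomputable def relMod (m : ℕ) (W : Type*) [AddCommGroup W] [Module ℂ W] :
    Submodule (PolyRing (g.Deg 1)) (polyMap (g.Deg 1) W) where
  carrier := {p | (p : g.Deg 1 → W) ∈ g.rel m W}
  add_mem' := (g.rel m W).add_mem
  zero_mem' := (g.rel m W).zero_mem
  smul_mem' := fun c _ hx => rel_smul c.2 hx

/-- The relations as an ideal of the algebra of polynomial functions. -/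
noncomputable def relIdeal (m : ℕ) : Ideal (PolyRing (g.Deg 1)) where
  carrier := {f | f.1 ∈ g.rel m ℂ}
  add_mem' := (g.rel m ℂ).add_mem
  zero_mem' := (g.rel m ℂ).zero_mem
  smul_mem' := fun c _ hx => rel_smul c.2 hx

theorem relMod_anti (m : ℕ) (W : Type*) [AddCommGroup W] [Module ℂ W] :
    g.relMod (m + 1) W ≤ g.relMod m W := fun _ h => rel_anti (W := W) h

theorem relIdeal_anti (m : ℕ) : g.relIdeal (m + 1) ≤ g.relIdeal m :=
  fun f (h : f.1 ∈ g.rel (m + 1) ℂ) => (rel_anti h : f.1 ∈ g.rel m ℂ)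

/-- The universal deformation ring `R_m = H^0(*J_m) = H^0(L_m(ℂ))`. -/
def R (m : ℕ) : Type u := PolyRing (g.Deg 1) ⧸ g.relIdeal m

noncomputable instance (m : ℕ) : CommRing (g.R m) :=
  inferInstanceAs (CommRing (PolyRing (g.Deg 1) ⧸ g.relIdeal m))

noncomputable instance (m : ℕ) : Algebra ℂ (g.R m) :=
  inferInstanceAs (Algebra ℂ (PolyRing (g.Deg 1) ⧸ g.relIdeal m))

/-- The class in `R_m` of a polynomial function on `g^1`. -/
noncomputable def Rmk (m : ℕ) : PolyRing (g.Deg 1) →ₐ[ℂ] g.R m :=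
  Ideal.Quotient.mkₐ ℂ (g.relIdeal m)

/-- The restriction map `R_(m+1) → R_m`. -/
noncomputable def resR (m : ℕ) : g.R (m + 1) →ₐ[ℂ] g.R m :=
  Ideal.Quotient.factorₐ ℂ (g.relIdeal_anti m)

/-- `R_m` is an `R_(m+1)`-algebra through the restriction map. -/
noncomputable instance (m : ℕ) : Algebra (g.R (m + 1)) (g.R m) := (g.resR m).toRingHom.toAlgebra

/-- The term `L_m(G)^p` of the `L`-complex of a differential graded `g`-module `G` with
`G^p = W`: the cokernel of `Hom (J_m^1, W) → Hom (J_m^0, W)`. -/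
abbrev LTerm (m : ℕ) (W : Type*) [AddCommGroup W] [Module ℂ W] : Type _ :=
  polyMap (g.Deg 1) W ⧸ g.relMod m W

/-- The horizontal differential `Hom (J^0, g^p) → Hom (J^0, g^(p+1))` for the adjoint module:
the differential of `g` plus the transpose of the bracket. -/
noncomputable def covDiff (p : ℕ) :
    polyMap (g.Deg 1) (g.Deg p) →ₗ[PolyRing (g.Deg 1)] polyMap (g.Deg 1) (g.Deg (p + 1)) where
  toFun q := ⟨fun x => g.d p (q.1 x) + g.br p x (q.1 x), Submodule.add_mem _
    (polyGE_comp (g.d p) q.2) (polyGE_anti (Nat.zero_le _)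
      (polyGE_bilin (g.br p) (polyGE_linear LinearMap.id) q.2))⟩
  map_add' q q' := Subtype.ext <| funext fun x => by
    simp [add_add_add_comm]
  map_smul' f q := Subtype.ext <| funext fun x => by
    change g.d p (f.1 x • q.1 x) + g.br p x (f.1 x • q.1 x) =
      f.1 x • (g.d p (q.1 x) + g.br p x (q.1 x))
    simp

theorem covDiff_rel (m p : ℕ) :
    g.relMod m (g.Deg p) ≤ (g.relMod m (g.Deg (p + 1))).comap (g.covDiff p) := fun _ hq =>
  Submodule.add_mem (g.rel m (g.Deg (p + 1))) (rel_comp (g.d p) hq)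
    (rel_bilin (g.br p) (polyGE_anti (Nat.zero_le _) (polyGE_linear LinearMap.id)) hq)

/-- The differential `L_m(g)^p → L_m(g)^(p+1)` of the complex `L_m(g)`. -/
noncomputable def dL (m p : ℕ) :
    g.LTerm m (g.Deg p) →ₗ[PolyRing (g.Deg 1)] g.LTerm m (g.Deg (p + 1)) :=
  Submodule.mapQ _ _ (g.covDiff p) (g.covDiff_rel m p)

/-- `L_m(g)` is a complex. -/
theorem dL_dL (m p : ℕ) : g.dL m (p + 1) ∘ₗ g.dL m p = 0 := by
  refine Submodule.linearMap_qext _ (LinearMap.ext fun q => ?_)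
  change Submodule.Quotient.mk (g.covDiff (p + 1) (g.covDiff p q)) = 0
  rw [Submodule.Quotient.mk_eq_zero]
  let T : g.Deg p →ₗ[ℂ] g.Deg 2 →ₗ[ℂ] g.Deg (p + 1 + 1) := LinearMap.mk₂ ℂ
    (fun y z => ⟨g.bracket z y, by
      have h := g.bracket_mem z.2 y.2
      rwa [show 2 + p = p + 1 + 1 by omega] at h⟩)
    (fun _ _ _ => Subtype.ext (by simp)) (fun _ _ _ => Subtype.ext (by simp))
    (fun _ _ _ => Subtype.ext (by simp)) (fun _ _ _ => Subtype.ext (by simp))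
  refine mem_rel.2 ⟨0, Submodule.zero_mem _, fun x => T (q.1 x), polyGE_comp T q.2, ?_⟩
  funext x
  apply Subtype.ext
  have h1 := g.leibniz x.2 (q.1 x).2
  have h2 := g.jacobi x.2 x.2 (q.1 x).2
  have h2' : g.bracket (g.bracket x x) (q.1 x) =
      (2 : ℂ) • g.bracket x (g.bracket x (q.1 x)) := by
    rw [two_smul]; rw [mul_one, pow_one, neg_one_smul] at h2
    exact add_neg_eq_iff_eq_add.1 h2.symm
  change g.diff (g.diff (q.1 x) + g.bracket x (q.1 x)) +
    g.bracket x (g.diff (q.1 x) + g.bracket x (q.1 x)) =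
    0 + g.bracket (g.diff x + (1 / 2 : ℂ) • g.bracket x x) (q.1 x)
  simp only [map_add, LinearMap.add_apply, map_smul, LinearMap.smul_apply, h1, h2', g.diff_diff,
    smul_smul]
  norm_num

/-- `Θ_m = H^1(L_m(g))`. -/
def Theta (m : ℕ) : Type u :=
  ↥(LinearMap.ker (g.dL m 1)) ⧸
    (LinearMap.range (g.dL m 0)).comap (LinearMap.ker (g.dL m 1)).subtype

noncomputable instance (m : ℕ) : AddCommGroup (g.Theta m) :=
  inferInstanceAs (AddCommGroup (↥(LinearMap.ker (g.dL m 1)) ⧸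
    (LinearMap.range (g.dL m 0)).comap (LinearMap.ker (g.dL m 1)).subtype))

noncomputable instance (m : ℕ) : Module (PolyRing (g.Deg 1)) (g.Theta m) :=
  inferInstanceAs (Module (PolyRing (g.Deg 1)) (↥(LinearMap.ker (g.dL m 1)) ⧸
    (LinearMap.range (g.dL m 0)).comap (LinearMap.ker (g.dL m 1)).subtype))

noncomputable instance (m : ℕ) : Module ℂ (g.Theta m) :=
  inferInstanceAs (Module ℂ (↥(LinearMap.ker (g.dL m 1)) ⧸
    (LinearMap.range (g.dL m 0)).comap (LinearMap.ker (g.dL m 1)).subtype))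

instance (m : ℕ) : IsScalarTower ℂ (PolyRing (g.Deg 1)) (g.Theta m) :=
  inferInstanceAs (IsScalarTower ℂ (PolyRing (g.Deg 1)) (↥(LinearMap.ker (g.dL m 1)) ⧸
    (LinearMap.range (g.dL m 0)).comap (LinearMap.ker (g.dL m 1)).subtype))

/-- A polynomial vector field `p` on `g^1` represents a cocycle in `L_m(g)^1`. -/
def IsClosed (m : ℕ) (p : polyMap (g.Deg 1) (g.Deg 1)) : Prop :=
  g.covDiff 1 p ∈ g.relMod m (g.Deg (1 + 1))

variable {g}

theorem dL_mk {m : ℕ} (p : polyMap (g.Deg 1) (g.Deg 1)) :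
    g.dL m 1 (Submodule.Quotient.mk p) = 0 ↔ g.IsClosed m p := by
  rw [dL, Submodule.mapQ_apply, Submodule.Quotient.mk_eq_zero]; rfl

/-- The class in `Θ_m` of a polynomial vector field that represents a cocycle. -/
noncomputable def thetaMk (m : ℕ) (p : polyMap (g.Deg 1) (g.Deg 1)) (hp : g.IsClosed m p) : g.Theta m :=
  Submodule.Quotient.mk ⟨Submodule.Quotient.mk p, LinearMap.mem_ker.2 ((dL_mk p).2 hp)⟩

theorem thetaMk_surj {m : ℕ} (θ : g.Theta m) :
    ∃ (p : polyMap (g.Deg 1) (g.Deg 1)) (hp : g.IsClosed m p), thetaMk m p hp = θ := by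
  obtain ⟨⟨z, hz⟩, rfl⟩ := Submodule.Quotient.mk_surjective _ θ
  obtain ⟨p, rfl⟩ := Submodule.Quotient.mk_surjective _ z
  exact ⟨p, (dL_mk p).1 hz, rfl⟩

theorem range_dL_zero (m : ℕ) : LinearMap.range (g.dL m 0) = ⊥ := by
  rw [LinearMap.range_eq_bot]
  refine Submodule.linearMap_qext _ (LinearMap.ext fun q => ?_)
  have : q = 0 := Subtype.ext <| funext fun x => Subtype.ext <| by
    exact (Submodule.mem_bot ℂ).1 (g.deg_zero.le (q.1 x).2)
  rw [this, map_zero, map_zero]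

theorem thetaMk_eq {m : ℕ} {p p' : polyMap (g.Deg 1) (g.Deg 1)} {hp : g.IsClosed m p}
    {hp' : g.IsClosed m p'} :
    thetaMk m p hp = thetaMk m p' hp' ↔ p - p' ∈ g.relMod m (g.Deg 1) := by
  refine (Submodule.Quotient.eq
    ((LinearMap.range (g.dL m 0)).comap (LinearMap.ker (g.dL m 1)).subtype)).trans ?_
  rw [Submodule.mem_comap]
  refine (range_dL_zero (g := g) m).le.antisymm bot_le ▸ ?_
  refine Iff.trans (Submodule.mem_bot _) ?_
  refine Iff.trans ?_ (Submodule.Quotient.eq (g.relMod m (g.Deg 1)))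
  exact sub_eq_zero

theorem theta_torsion (m : ℕ) :
    Module.IsTorsionBySet (PolyRing (g.Deg 1)) (g.Theta m) (g.relIdeal m) := by
  rintro θ ⟨f, hf⟩
  obtain ⟨p, hp, rfl⟩ := thetaMk_surj θ
  change Submodule.Quotient.mk (f • (⟨Submodule.Quotient.mk p, _⟩ : LinearMap.ker (g.dL m 1))) = _
  have : f • (⟨Submodule.Quotient.mk p, (dL_mk p).2 hp⟩ : LinearMap.ker (g.dL m 1)) = 0 := by
    apply Subtype.ext
    change f • (Submodule.Quotient.mk p : g.LTerm m (g.Deg 1)) = 0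
    rw [← Submodule.Quotient.mk_smul, Submodule.Quotient.mk_eq_zero]
    exact rel_bilin (LinearMap.lsmul ℂ (g.Deg 1)).flip p.2 hf
  rw [this]; rfl

/-- The `R_m`-module structure of `Θ_m`. -/
noncomputable instance (m : ℕ) : Module (g.R m) (g.Theta m) := (theta_torsion m).module

variable (g)

/-- The restriction map `L_(m+1)(g)^p → L_m(g)^p`. -/
noncomputable def resL (m p : ℕ) :
    g.LTerm (m + 1) (g.Deg p) →ₗ[PolyRing (g.Deg 1)] g.LTerm m (g.Deg p) :=
  Submodule.factor (g.relMod_anti m (g.Deg p))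

theorem dL_resL (m p : ℕ) (z : g.LTerm (m + 1) (g.Deg p)) :
    g.dL m p (g.resL m p z) = g.resL m (p + 1) (g.dL (m + 1) p z) := by
  obtain ⟨q, rfl⟩ := Submodule.Quotient.mk_surjective _ z
  rfl

/-- The restriction map `Θ_(m+1) → Θ_m`, induced by the restriction map of `L`-complexes. -/
noncomputable def resThetaPoly (m : ℕ) : g.Theta (m + 1) →ₗ[PolyRing (g.Deg 1)] g.Theta m :=
  Submodule.mapQ _ ((LinearMap.range (g.dL m 0)).comap (LinearMap.ker (g.dL m 1)).subtype)
    ((g.resL m 1).restrict (p := LinearMap.ker (g.dL (m + 1) 1)) (q := LinearMap.ker (g.dL m 1))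
      fun z hz => by
        rw [LinearMap.mem_ker] at hz ⊢
        rw [dL_resL, hz, map_zero])
    (by
      rintro ⟨_, _⟩ ⟨w, rfl⟩
      exact ⟨g.resL m 0 w, g.dL_resL m 0 w⟩)

/-- The restriction map `Θ_(m+1) → Θ_m`, as a `ℂ`-linear map. -/
noncomputable def resTheta (m : ℕ) : g.Theta (m + 1) →ₗ[ℂ] g.Theta m :=
  (g.resThetaPoly m).restrictScalars ℂ

variable {g}

theorem IsClosed.res {m : ℕ} {p : polyMap (g.Deg 1) (g.Deg 1)} (hp : g.IsClosed (m + 1) p) :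
    g.IsClosed m p := g.relMod_anti m _ hp

theorem resTheta_mk {m : ℕ} {p : polyMap (g.Deg 1) (g.Deg 1)} (hp : g.IsClosed (m + 1) p) :
    g.resTheta m (thetaMk (m + 1) p hp) = thetaMk m p hp.res := rfl

/-! ### The action pairing and the bracket pairing -/

section act

variable {W : Type*} [AddCommGroup W] [Module ℂ W]

/-- The derivative of a polynomial map along a polynomial vector field: the vector field is
contracted with the `Hom (J, ·)`-factor of the polynomial map. -/
noncomputable def act (u : polyMap (g.Deg 1) (g.Deg 1)) (p : polyMap (g.Deg 1) W) :
    polyMap (g.Deg 1) W :=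
  ⟨polyAct u.1 p.1, polyGE_anti (Nat.zero_le _) (polyAct_mem (a := 0) u.2 p.2)⟩

theorem polyAct_curv (u : g.Deg 1 → g.Deg 1) :
    polyAct u g.curv = fun x => g.d 1 (u x) + g.br 1 x (u x) := by
  have hid : (fun x : g.Deg 1 => x) ∈ polyGE (g.Deg 1) (g.Deg 1) 0 :=
    polyGE_anti (Nat.zero_le _) (polyGE_linear LinearMap.id)
  have h1 : (fun x => g.d 1 x) ∈ polyGE (g.Deg 1) (g.Deg 2) 0 :=
    polyGE_anti (Nat.zero_le _) (polyGE_linear (g.d 1))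
  have hβ := polyGE_bilin_zero ((1 / 2 : ℂ) • g.br 1) hid hid
  have e : g.curv = (fun x => g.d 1 x) + fun x => ((1 / 2 : ℂ) • g.br 1) x x := rfl
  have hb := polyAct_bilin ((1 / 2 : ℂ) • g.br 1) u hid hid
  rw [e, polyAct_add u h1 hβ, polyAct_linear, hb]
  have hl : polyAct u (fun x : g.Deg 1 => x) = u := polyAct_linear u LinearMap.id
  rw [hl]
  funext x
  simp only [Pi.add_apply, LinearMap.smul_apply]
  have hs : g.br 1 (u x) x = g.br 1 x (u x) := by
    apply Subtype.ext
    have := g.bracket_skew (u x).2 x.2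
    simp only [mul_one, pow_one, neg_one_smul, neg_neg] at this
    exact this
  rw [hs, ← add_smul]
  norm_num

/-- A cocycle acts compatibly with the relations. -/
theorem act_rel {m : ℕ} {u : polyMap (g.Deg 1) (g.Deg 1)} (hu : g.IsClosed m u)
    {p : g.Deg 1 → W} (hp : p ∈ g.rel (m + 1) W) : polyAct u.1 p ∈ g.rel m W := by
  obtain ⟨e, he, Q, hQ, rfl⟩ := mem_rel.1 hp
  have hQc := polyGE_bilin_zero (LinearMap.id (R := ℂ) (M := g.Deg 2 →ₗ[ℂ] W)) hQ
    (curv_poly (g := g))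
  simp only [LinearMap.id_apply] at hQc
  rw [polyAct_add u.1 (polyGE_anti (Nat.zero_le _) he) hQc]
  have hb := polyAct_bilin (LinearMap.id (R := ℂ) (M := g.Deg 2 →ₗ[ℂ] W)) u.1 hQ
    (curv_poly (g := g))
  simp only [LinearMap.id_apply] at hb
  rw [hb, polyAct_curv u.1]
  have h1 : polyAct u.1 e ∈ polyGE (g.Deg 1) W (m + 1) := by
    have h := polyAct_mem (a := 0) u.2 he
    rwa [add_zero, Nat.add_sub_cancel] at h
  have h2 : polyAct u.1 Q ∈ polyGE (g.Deg 1) (g.Deg 2 →ₗ[ℂ] W) 0 :=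
    polyGE_anti (Nat.zero_le _) (polyAct_mem (a := 0) u.2 hQ)
  have h3 : (fun x => polyAct u.1 Q x (g.curv x)) ∈ g.rel m W :=
    mem_rel.2 ⟨0, Submodule.zero_mem _, _, h2, (zero_add _).symm⟩
  have h4 := rel_bilin (LinearMap.id (R := ℂ) (M := g.Deg 2 →ₗ[ℂ] W)) hQ hu
  exact Submodule.add_mem _ (Submodule.mem_sup_left h1) (Submodule.add_mem _ h3 h4)

/-- A trivial vector field acts trivially. -/
theorem act_rel_left {m : ℕ} {u : g.Deg 1 → g.Deg 1} (hu : u ∈ g.rel m (g.Deg 1))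
    {p : g.Deg 1 → W} (hp : p ∈ polyGE (g.Deg 1) W 0) : polyAct u p ∈ g.rel m W := by
  obtain ⟨D, hD, h⟩ := exists_deriv hp
  have : polyAct u p = fun x => D x (u x) := funext fun x => (h x (u x)).eq
  rw [this]
  exact rel_bilin (LinearMap.id (R := ℂ) (M := g.Deg 1 →ₗ[ℂ] W)) hD hu

theorem act_sub_mem {m : ℕ} {u u' : polyMap (g.Deg 1) (g.Deg 1)} (hu' : g.IsClosed m u')
    (huu' : u - u' ∈ g.relMod m (g.Deg 1)) {p p' : g.Deg 1 → W} (hp : p ∈ polyGE (g.Deg 1) W 0)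
    (hp' : p' ∈ polyGE (g.Deg 1) W 0) (hpp' : p - p' ∈ g.rel (m + 1) W) :
    polyAct u.1 p - polyAct u'.1 p' ∈ g.rel m W := by
  have h1 := act_rel_left (g := g) (m := m) huu' hp
  have h2 := act_rel hu' hpp'
  change polyAct (u.1 - u'.1) p ∈ _ at h1
  rw [polyAct_sub_left _ _ hp] at h1
  rw [polyAct_sub _ hp hp'] at h2
  have := Submodule.add_mem _ h1 h2
  rwa [sub_add_sub_cancel] at this

end act

/-- The action of a polynomial vector field on a polynomial function. -/
noncomputable def actFun (u : polyMap (g.Deg 1) (g.Deg 1)) (f : PolyRing (g.Deg 1)) :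
    PolyRing (g.Deg 1) :=
  ⟨polyAct u.1 f.1, polyGE_anti (Nat.zero_le _) (polyAct_mem (a := 0) u.2 f.2)⟩

theorem Rmk_eq {m : ℕ} {f f' : PolyRing (g.Deg 1)} :
    g.Rmk m f = g.Rmk m f' ↔ f.1 - f'.1 ∈ g.rel m ℂ :=
  Ideal.Quotient.eq (I := g.relIdeal m)

theorem Rmk_surj {m : ℕ} (r : g.R m) : ∃ f, g.Rmk m f = r := Ideal.Quotient.mk_surjective r

variable (g)

/-- The action pairing `Θ_m × R_(m+1) → R_m`: the `g^1`-factor of a cocycle in `L_m(g)^1` is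
contracted with the `*J_(m+1)`-factor, that is, a function is differentiated along a vector
field; see `actionPairing_mk`. -/
noncomputable def actionPairing (m : ℕ) (θ : g.Theta m) (r : g.R (m + 1)) : g.R m :=
  g.Rmk m (actFun (thetaMk_surj θ).choose (Rmk_surj r).choose)

/-- The action pairing is computed on arbitrary representatives. -/
theorem actionPairing_mk (m : ℕ) (u : polyMap (g.Deg 1) (g.Deg 1)) (hu : g.IsClosed m u)
    (f : PolyRing (g.Deg 1)) :
    g.actionPairing m (thetaMk m u hu) (g.Rmk (m + 1) f) = g.Rmk m (actFun u f) := by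
  rw [actionPairing, Rmk_eq]
  obtain ⟨h, h'⟩ := (thetaMk_surj (thetaMk m u hu)).choose_spec
  exact act_sub_mem hu (thetaMk_eq.1 h') (PolyRing.prop _) f.prop
    (Rmk_eq.1 (Rmk_surj (g.Rmk (m + 1) f)).choose_spec)

/-- The Lie bracket of polynomial vector fields. -/
noncomputable def vbr (u v : polyMap (g.Deg 1) (g.Deg 1)) : polyMap (g.Deg 1) (g.Deg 1) :=
  act u v - act v u

variable {g}

theorem vbr_closed {m : ℕ} {u v : polyMap (g.Deg 1) (g.Deg 1)} (hu : g.IsClosed (m + 1) u)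
    (hv : g.IsClosed (m + 1) v) : g.IsClosed m (g.vbr u v) := by
  have hid : (fun x : g.Deg 1 => x) ∈ polyGE (g.Deg 1) (g.Deg 1) 0 :=
    polyGE_anti (Nat.zero_le _) (polyGE_linear LinearMap.id)
  have key : ∀ u v : polyMap (g.Deg 1) (g.Deg 1), polyAct u.1 (g.covDiff 1 v).1 =
      (g.covDiff 1 (act u v)).1 + fun x => g.br 1 (u.1 x) (v.1 x) := by
    intro u v
    have h1 := polyGE_comp (g.d 1) v.2
    have h2 := polyGE_bilin_zero (g.br 1) hid v.2
    have e : (g.covDiff 1 v).1 = (fun x => g.d 1 (v.1 x)) + fun x => g.br 1 x (v.1 x) := rfl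
    have hl : polyAct u.1 (fun x : g.Deg 1 => x) = u.1 := polyAct_linear u.1 LinearMap.id
    rw [e, polyAct_add u.1 h1 h2, polyAct_comp (g.d 1) u.1 v.2,
      polyAct_bilin (g.br 1) u.1 hid v.2, hl]
    funext x
    change g.d 1 (polyAct u.1 v.1 x) + (g.br 1 (u.1 x) (v.1 x) + g.br 1 x (polyAct u.1 v.1 x)) =
      g.d 1 (polyAct u.1 v.1 x) + g.br 1 x (polyAct u.1 v.1 x) + g.br 1 (u.1 x) (v.1 x)
    abel
  have a := act_rel hu.res hv
  have b := act_rel hv.res hu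
  rw [key] at a b
  have c := Submodule.sub_mem _ a b
  have hs : (fun x => g.br 1 (u.1 x) (v.1 x)) = fun x => g.br 1 (v.1 x) (u.1 x) := by
    funext x
    apply Subtype.ext
    have := g.bracket_skew (u.1 x).2 (v.1 x).2
    simp only [mul_one, pow_one, neg_one_smul, neg_neg] at this
    exact this
  rw [hs, add_sub_add_right_eq_sub] at c
  change (g.covDiff 1 (act u v - act v u)).1 ∈ g.rel m (g.Deg (1 + 1))
  rw [map_sub]
  exact c

variable (g)

/-- The bracket pairing `B_(m+1) : Θ_(m+1) × Θ_(m+1) → Θ_m`: the `g^1`-factor of each cocycle is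
contracted with the `*J`-factor of the other one, and the difference is taken. For `m = 0` the
classes of `a + ∑ ⟨cᵢ, x⟩ bᵢ` and `a' + ∑ ⟨c'ᵢ, x⟩ b'ᵢ` have the bracket
`∑ ⟨c'ᵢ, a⟩ b'ᵢ - ∑ ⟨cᵢ, a'⟩ bᵢ`; see `bracketPairing_mk`. -/
noncomputable def bracketPairing (m : ℕ) (θ η : g.Theta (m + 1)) : g.Theta m :=
  thetaMk m (g.vbr (thetaMk_surj θ).choose (thetaMk_surj η).choose)
    (vbr_closed (thetaMk_surj θ).choose_spec.choose (thetaMk_surj η).choose_spec.choose)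

/-- The bracket pairing is computed on arbitrary representatives. -/
theorem bracketPairing_mk (m : ℕ) (u v : polyMap (g.Deg 1) (g.Deg 1))
    (hu : g.IsClosed (m + 1) u) (hv : g.IsClosed (m + 1) v) :
    g.bracketPairing m (thetaMk (m + 1) u hu) (thetaMk (m + 1) v hv) =
      thetaMk m (g.vbr u v) (vbr_closed hu hv) := by
  rw [bracketPairing, thetaMk_eq]
  obtain ⟨h, h'⟩ := (thetaMk_surj (thetaMk (m + 1) u hu)).choose_spec
  obtain ⟨k, k'⟩ := (thetaMk_surj (thetaMk (m + 1) v hv)).choose_spec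
  have a := thetaMk_eq.1 h'
  have b := thetaMk_eq.1 k'
  have c := Submodule.sub_mem _
    (act_sub_mem hu.res (g.relMod_anti m _ a) (thetaMk_surj (thetaMk (m + 1) v hv)).choose.2 v.2 b)
    (act_sub_mem hv.res (g.relMod_anti m _ b) (thetaMk_surj (thetaMk (m + 1) u hu)).choose.2 u.2 a)
  rw [sub_sub_sub_comm] at c
  exact c

/-! ### Inverse limits and unobstructedness -/

/-- `lim R_m` as a subalgebra of the product. -/
noncomputable def RHatSubalgebra : Subalgebra ℂ (∀ m, g.R m) where
  carrier := {f | ∀ m, g.resR m (f (m + 1)) = f m}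
  mul_mem' := fun ha hb m => by simp [ha m, hb m]
  add_mem' := fun ha hb m => by simp [ha m, hb m]
  algebraMap_mem' := fun c m => (g.resR m).commutes c

/-- The universal deformation ring, the inverse limit of the rings `R_m`. -/
def RHat : Type u := ↥g.RHatSubalgebra

noncomputable instance : CommRing g.RHat := inferInstanceAs (CommRing g.RHatSubalgebra)

noncomputable instance : Algebra ℂ g.RHat := inferInstanceAs (Algebra ℂ g.RHatSubalgebra)

/-- The inverse limit of the spaces `Θ_m`. -/
noncomputable def ThetaHat : Submodule ℂ (∀ m, g.Theta m) where
  carrier := {u | ∀ m, g.resTheta m (u (m + 1)) = u m}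
  add_mem' := fun ha hb m => by simp [ha m, hb m]
  zero_mem' := fun m => by simp
  smul_mem' := fun c u hu m => by simp [hu m]

open scoped TensorProduct in
/-- The Maurer-Cartan elements of `g` over a local algebra `S` with maximal ideal `𝔪`, that is,
the `g`-deformations over `S`: the elements `x` of `𝔪 ⊗ g^1` with `δ x + [x, x] / 2 = 0`. -/
def IsMC (S : Type) [CommRing S] [Algebra ℂ S] [IsLocalRing S] (x : S ⊗[ℂ] g.Deg 1) : Prop :=
  x ∈ (IsLocalRing.maximalIdeal S • ⊤ : Submodule S (S ⊗[ℂ] g.Deg 1)) ∧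
    (g.d 1).lTensor S x +
      (1 / 2 : ℂ) • TensorProduct.map₂ (LinearMap.mul ℂ S) (g.br 1) x x = 0

open scoped TensorProduct in
/-- `g` has unobstructed deformations: for every surjection of finite-dimensional local
`ℂ`-algebras, every `g`-deformation over the target lifts to the source. -/
def Unobstructed : Prop :=
  ∀ (S' S : Type) [CommRing S'] [Algebra ℂ S'] [IsLocalRing S'] [FiniteDimensional ℂ S']
    [CommRing S] [Algebra ℂ S] [IsLocalRing S] [FiniteDimensional ℂ S] (π : S' →ₐ[ℂ] S),
    Function.Surjective π → ∀ x : S ⊗[ℂ] g.Deg 1, g.IsMC S x →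
      ∃ x' : S' ⊗[ℂ] g.Deg 1, g.IsMC S' x' ∧ π.toLinearMap.rTensor (g.Deg 1) x' = x

end PosDGLA

/-! The engine is the Kuranishi argument. Since `g` vanishes in degree `0`, the kernel of `δ` on
`g^1` embeds in `g.Coh 1`, so it is finite dimensional. This gives finitely many functionals `lam
i`, vectors `e i` and a linear `T : g^2 → g^1` with `x = T (δ x) + ∑ lam i x • e i`
(`exists_coords`). Modulo the relations `δ x = -[x, x] / 2`, so `x = ∑ lam i x • e i - T [x, x] /
2`. Iterating, each round gaining one order, yields a polynomial `φ` in the coordinates `lam i` with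
`x - φ x` a relation (`exists_kuranishi`). Hence, modulo relations, every polynomial map is a finite
combination of vectors with coefficients polynomial in the coordinates. Three consequences carry the
proof: the coordinates generate `R_m`; a polynomial map is a relation as soon as all its scalar
components are (`mem_rel_of_dual`); and a map of order `> k` can be divided by the coordinates, with
quotients of order `≥ k` (`exists_division`).

Each `A_m` is then bijective. It is injective because a class that kills all linear functions has
all its components in the relations. For surjectivity, write `φ = ∑ f i • v i`; a derivation `D` can
only come from `u = ∑ D (f i) • v i`, and `D` applied to the Maurer-Cartan equation of `φ` says that
`u` is a cocycle.

The commutator of two actions satisfies the Leibniz rule, so (ii) need only be compared on the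
coordinates. By injectivity of the action, the bracket inherits bilinearity, alternation and, in the
limit, the Jacobi identity from derivations.

In the limit, the point is that every derivation of `RHat` is automatically continuous: division,
carried out order by order, shows that an element vanishing in `R_(k+1)` is a combination of
coordinates with coefficients vanishing in `R_k`. A derivation thus descends to `R_(m+1) → R_m` for
each `m`, where `A_m` can be inverted, and the resulting classes are compatible by injectivity. -/

/-- A linear functional, as a polynomial function. -/
def PolyRing.lin {V : Type*} [AddCommGroup V] [Module ℂ V] (l : Module.Dual ℂ V) : PolyRing V :=
  ⟨fun x => l x, polyGE_anti (Nat.zero_le _) (polyGE_linear l)⟩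

theorem polyGE_id {V : Type*} [AddCommGroup V] [Module ℂ V] : (fun x : V => x) ∈ polyGE V V 1 :=
  polyGE_linear LinearMap.id

theorem polyGE_id_zero {V : Type*} [AddCommGroup V] [Module ℂ V] :
    (fun x : V => x) ∈ polyGE V V 0 :=
  polyGE_anti (Nat.zero_le _) polyGE_id

/-- A homogeneous polynomial map of positive degree is obtained by evaluating a homogeneous
polynomial map with values in linear maps. -/
theorem IsHomogPoly.exists_eval {V W : Type*} [AddCommGroup V] [Module ℂ V] [AddCommGroup W]
    [Module ℂ W] {k : ℕ} {p : V → W} (hp : IsHomogPoly (k + 1) p) :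
    ∃ P : V → V →ₗ[ℂ] W, IsHomogPoly k P ∧ p = fun x => P x x := by
  obtain ⟨F, hF⟩ := hp
  refine ⟨fun x => F.curryRight fun _ => x, ⟨F.curryRight, fun _ => rfl⟩, ?_⟩
  funext x
  rw [hF, MultilinearMap.curryRight_apply]
  congr 1
  funext i
  refine Fin.lastCases ?_ (fun j => ?_) i <;> simp

namespace PosDGLA

variable {L : Type u} [AddCommGroup L] [Module ℂ L] {g : PosDGLA L}
variable {W W₁ W₂ W₃ : Type*} [AddCommGroup W] [Module ℂ W] [AddCommGroup W₁] [Module ℂ W₁]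
  [AddCommGroup W₂] [Module ℂ W₂] [AddCommGroup W₃] [Module ℂ W₃]

theorem polyGE_le_rel (m : ℕ) : polyGE (g.Deg 1) W (m + 1) ≤ g.rel m W := le_sup_left

/-- Multiplication by a polynomial map without constant term raises the truncation order of a
relation. -/
theorem rel_bilin_one (β : W₁ →ₗ[ℂ] W₂ →ₗ[ℂ] W₃) {m : ℕ} {p : g.Deg 1 → W₁} {q : g.Deg 1 → W₂}
    (hp : p ∈ polyGE (g.Deg 1) W₁ 1) (hq : q ∈ g.rel m W₂) :
    (fun x => β (p x) (q x)) ∈ g.rel (m + 1) W₃ := by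
  obtain ⟨e, he, Q, hQ, rfl⟩ := mem_rel.1 hq
  have h1 := polyGE_bilin β hp he
  rw [add_comm 1] at h1
  have h2 := polyGE_bilin_zero ((LinearMap.llcomp ℂ (g.Deg 2) W₂ W₃) ∘ₗ β)
    (polyGE_anti (Nat.zero_le _) hp) hQ
  refine mem_rel.2 ⟨_, h1, _, h2, ?_⟩
  funext x
  simp only [Pi.add_apply, map_add, LinearMap.comp_apply, LinearMap.llcomp_apply]

theorem br_one_symm (x y : g.Deg 1) : g.br 1 x y = g.br 1 y x := by
  apply Subtype.ext
  have := g.bracket_skew x.2 y.2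
  simp only [mul_one, pow_one, neg_one_smul, neg_neg] at this
  exact this

/-! ### Linear coordinates from the finiteness of the first cohomology -/

variable (g) in
/-- Finitely many linear coordinates `lam i` on `g^1`, which together with a linear map
`T : g^2 → g^1` recover `x` from `δ x`. -/
structure Coords (n : ℕ) where
  lam : Fin n → Module.Dual ℂ (g.Deg 1)
  e : Fin n → g.Deg 1
  T : g.Deg 2 →ₗ[ℂ] g.Deg 1
  eq_add : ∀ x, x = T (g.d 1 x) + ∑ i, lam i x • e i

/-- There are no coboundaries in degree `1`. -/
theorem eq_zero_of_mem_deg_one_of_mem_range_diff {a : L} (ha : a ∈ g.deg 1)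
    (ha' : a ∈ LinearMap.range g.diff) :
    a = 0 := by
  classical
  let _ := g.isInternal.chooseDecomposition
  obtain ⟨b, rfl⟩ := ha'
  have key : ∀ b : L, (DirectSum.decompose g.deg (g.diff b) 1 : L) = 0 := by
    intro b
    induction b using DirectSum.Decomposition.inductionOn g.deg with
    | zero => simp
    | @homogeneous i b =>
      rcases Nat.eq_zero_or_pos i with rfl | hi
      · have : (b : L) = 0 := (Submodule.mem_bot ℂ).1 (g.deg_zero.le b.2)
        simp [this]
      · exact DirectSum.decompose_of_mem_ne g.deg (g.diff_mem b.2) (by omega)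
    | add a b ha hb => simp [ha, hb]
  rw [← key b, DirectSum.decompose_of_mem_same g.deg ha]

/-- With no coboundaries in degree `1`, the cocycles of degree `1` inject into `g.Coh 1`. -/
theorem finiteDimensional_ker_d (h : FiniteDimensional ℂ (g.Coh 1)) :
    FiniteDimensional ℂ (LinearMap.ker (g.d 1)) := by
  have hmem : ∀ x : LinearMap.ker (g.d 1), (x : L) ∈ g.deg 1 ⊓ LinearMap.ker g.diff := fun x =>
    ⟨x.1.2, congrArg Subtype.val (LinearMap.mem_ker.1 x.2)⟩
  let φ : LinearMap.ker (g.d 1) →ₗ[ℂ] g.Coh 1 := (Submodule.mkQ _) ∘ₗ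
    (((g.deg 1).subtype ∘ₗ (LinearMap.ker (g.d 1)).subtype).codRestrict _ hmem)
  refine FiniteDimensional.of_injective φ ?_
  rw [← LinearMap.ker_eq_bot, LinearMap.ker_eq_bot']
  intro x hx
  have := (Submodule.Quotient.mk_eq_zero _).1 hx
  exact Subtype.ext (Subtype.ext (eq_zero_of_mem_deg_one_of_mem_range_diff x.1.2 this.2))

/-- `T` extends to `g^2` a linear section of `δ` over its image. Then `x - T (δ x)` is a cocycle,
and its components in a finite basis of the cocycles are the coordinates. -/
theorem exists_coords (h : FiniteDimensional ℂ (g.Coh 1)) : ∃ n, Nonempty (g.Coords n) := by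
  have := finiteDimensional_ker_d h
  obtain ⟨s, hs⟩ := (g.d 1).rangeRestrict.exists_rightInverse_of_surjective
    (LinearMap.range_rangeRestrict _)
  obtain ⟨T, hT⟩ := LinearMap.exists_extend s
  have hdT : ∀ x, g.d 1 (T (g.d 1 x)) = g.d 1 x := by
    intro x
    have h1 : T (g.d 1 x) = s ⟨g.d 1 x, x, rfl⟩ := LinearMap.congr_fun hT ⟨g.d 1 x, x, rfl⟩
    rw [h1]
    exact congrArg Subtype.val (LinearMap.congr_fun hs ⟨g.d 1 x, x, rfl⟩)
  let k : g.Deg 1 →ₗ[ℂ] LinearMap.ker (g.d 1) :=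
    (LinearMap.id - T ∘ₗ g.d 1).codRestrict _ fun x => by
      simp [LinearMap.mem_ker, hdT]
  let b := Module.finBasis ℂ (LinearMap.ker (g.d 1))
  refine ⟨_, ⟨⟨fun i => b.coord i ∘ₗ k, fun i => (b i).1, T, fun x => ?_⟩⟩⟩
  have h1 := congrArg Subtype.val (b.sum_repr (k x))
  have h2 : (k x).1 = x - T (g.d 1 x) := rfl
  simp only [AddSubmonoidClass.coe_finsetSum, Submodule.coe_smul] at h1
  simp only [LinearMap.comp_apply, Module.Basis.coord_apply]
  rw [h1, h2]; abel

/-! ### The Kuranishi map and reduction to polynomials in the coordinates -/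

namespace Coords

variable {n : ℕ} (c : g.Coords n)

/-- The algebra of polynomials in the coordinates. -/
noncomputable def alg : Subalgebra ℂ (PolyRing (g.Deg 1)) :=
  Algebra.adjoin ℂ (Set.range fun i => PolyRing.lin (c.lam i))

/-- The maps with values in `W` that are combinations of vectors with coefficients polynomials in
the coordinates. -/
def finType (W : Type*) [AddCommGroup W] [Module ℂ W] : Submodule ℂ (g.Deg 1 → W) :=
  Submodule.span ℂ {p | ∃ f ∈ c.alg, ∃ w : W, p = fun x => f.1 x • w}

variable {c}

theorem finType_le : c.finType W ≤ polyGE (g.Deg 1) W 0 := by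
  refine Submodule.span_le.2 ?_
  rintro _ ⟨f, -, w, rfl⟩
  exact polyGE_smul f.2 (polyGE_const w)

theorem finType_bilin (β : W₁ →ₗ[ℂ] W₂ →ₗ[ℂ] W₃) {p : g.Deg 1 → W₁} {q : g.Deg 1 → W₂}
    (hp : p ∈ c.finType W₁) (hq : q ∈ c.finType W₂) :
    (fun x => β (p x) (q x)) ∈ c.finType W₃ := by
  induction hp using Submodule.span_induction with
  | mem p hp =>
    obtain ⟨f, hf, w, rfl⟩ := hp
    induction hq using Submodule.span_induction with
    | mem q hq =>
      obtain ⟨f', hf', w', rfl⟩ := hq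
      refine Submodule.subset_span ⟨f * f', mul_mem hf hf', β w w', ?_⟩
      funext x
      simp only [map_smul, LinearMap.smul_apply, smul_smul]
      rw [mul_comm]; rfl
    | zero => simp only [Pi.zero_apply, map_zero]; exact Submodule.zero_mem _
    | add x y _ _ hx hy => simp only [Pi.add_apply, map_add]; exact Submodule.add_mem _ hx hy
    | smul a x _ hx => simp only [Pi.smul_apply, map_smul _ a]; exact Submodule.smul_mem _ a hx
  | zero => simp only [Pi.zero_apply, map_zero, LinearMap.zero_apply]; exact Submodule.zero_mem _
  | add x y _ _ hx hy =>
    simp only [Pi.add_apply, map_add, LinearMap.add_apply]; exact Submodule.add_mem _ hx hy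
  | smul c x _ hx =>
    simp only [Pi.smul_apply, map_smul, LinearMap.smul_apply]; exact Submodule.smul_mem _ c hx

theorem finType_const (w : W) : (fun _ => w) ∈ c.finType W :=
  Submodule.subset_span ⟨1, one_mem _, w, by funext x; exact (one_smul ℂ w).symm⟩

theorem finType_comp (S : W₁ →ₗ[ℂ] W₂) {p : g.Deg 1 → W₁} (hp : p ∈ c.finType W₁) :
    (fun x => S (p x)) ∈ c.finType W₂ :=
  finType_bilin (LinearMap.id (R := ℂ) (M := W₁ →ₗ[ℂ] W₂)) (finType_const S) hp

theorem finType_lam (i : Fin n) (w : W) : (fun x => c.lam i x • w) ∈ c.finType W :=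
  Submodule.subset_span ⟨_, Algebra.subset_adjoin ⟨i, rfl⟩, w, rfl⟩

variable (c) in
/-- Modulo relations, the identity of `g^1` is a polynomial in the coordinates (the Kuranishi
map). -/
theorem exists_kuranishi (m : ℕ) : ∃ φ ∈ c.finType (g.Deg 1),
    (fun x => x - φ x) ∈ g.rel m (g.Deg 1) ∧
    ∃ ψ : Fin n → g.Deg 1 → g.Deg 1, (∀ i, ψ i ∈ polyGE (g.Deg 1) (g.Deg 1) 0) ∧
      φ = fun x => ∑ i, c.lam i x • ψ i x := by
  induction m with
  | zero =>
    refine ⟨0, Submodule.zero_mem _, ?_, 0, fun i => Submodule.zero_mem _, by ext; simp⟩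
    -- At truncation order `0` the identity, having order `1`, is itself a relation, so `φ = 0`
    -- starts the iteration.
    simpa using polyGE_le_rel 0 (polyGE_id (V := g.Deg 1))
  | succ m ih =>
    obtain ⟨φ, hφ, hr, ψ, hψ, hφψ⟩ := ih
    have hφ0 := finType_le hφ
    have hφ1 : φ ∈ polyGE (g.Deg 1) (g.Deg 1) 1 := by
      have : φ = ∑ i, fun x => c.lam i x • ψ i x := by rw [hφψ]; ext x; simp
      rw [this]
      refine Submodule.sum_mem _ fun i _ => ?_
      simpa using polyGE_bilin (LinearMap.lsmul ℂ (g.Deg 1)) (polyGE_linear (c.lam i)) (hψ i)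
    -- Fixed-point iteration of `x = ∑ lam i x • e i - T [x, x] / 2`. The factorisation through the
    -- `ψ i` is carried along to show that `φ` has no constant term, and serves later for division.
    refine ⟨fun x => ∑ i, c.lam i x • c.e i - (1 / 2 : ℂ) • c.T (g.br 1 (φ x) (φ x)), ?_, ?_,
      fun i x => c.e i - (1 / 2 : ℂ) • c.T (g.br 1 (ψ i x) (φ x)), ?_, ?_⟩
    · refine Submodule.sub_mem _ ?_ (Submodule.smul_mem _ (1 / 2 : ℂ)
        (finType_comp c.T (finType_bilin (g.br 1) hφ hφ)))
      have : (fun x => ∑ i, c.lam i x • c.e i) = ∑ i, fun x => c.lam i x • c.e i := by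
        ext x; simp
      rw [this]
      exact Submodule.sum_mem _ fun i _ => finType_lam i (c.e i)
    · have h1 : (fun x => c.T (g.curv x)) ∈ g.rel (m + 1) (g.Deg 1) :=
        mem_rel.2 ⟨0, Submodule.zero_mem _, _, polyGE_const c.T, (zero_add _).symm⟩
      -- By symmetry of the bracket on `g^1`, this is `[x, x] - [φ x, φ x]`. The factor `x + φ x`
      -- has no constant term, which is where the order rises from `m` to `m + 1`.
      have h2 : (fun x => g.br 1 (x + φ x) (x - φ x)) ∈ g.rel (m + 1) (g.Deg 2) :=
        rel_bilin_one (g.br 1) (Submodule.add_mem _ polyGE_id hφ1) hr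
      have h3 := Submodule.sub_mem _ h1 (Submodule.smul_mem _ (1 / 2 : ℂ) (rel_comp c.T h2))
      refine (congrArg (· ∈ g.rel (m + 1) (g.Deg 1)) ?_).mp h3
      funext x
      have e1 := c.eq_add x
      have e2 : ∑ i, c.lam i x • c.e i = x - c.T (g.d 1 x) := by
        rw [eq_sub_iff_add_eq, add_comm]; exact e1.symm
      simp only [Pi.sub_apply, Pi.smul_apply, curv, map_add, map_sub, map_smul,
        LinearMap.add_apply, e2]
      rw [br_one_symm (φ x) x]
      module
    · intro i
      exact Submodule.sub_mem _ (polyGE_const _) (Submodule.smul_mem _ (1 / 2 : ℂ)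
        (polyGE_comp c.T (polyGE_bilin_zero (g.br 1) (hψ i) hφ0)))
    · funext x
      have : g.br 1 (φ x) (φ x) = ∑ i, c.lam i x • g.br 1 (ψ i x) (φ x) := by
        have h1 : φ x = ∑ i, c.lam i x • ψ i x := congrFun hφψ x
        have h2 : ∀ y, g.br 1 (φ x) y = ∑ i, c.lam i x • g.br 1 (ψ i x) y := by
          intro y
          rw [h1]
          simp only [map_sum, map_smul, LinearMap.sum_apply, LinearMap.smul_apply]
        exact h2 (φ x)
      rw [this]
      simp only [map_sum, map_smul, Finset.smul_sum, smul_sub, Finset.sum_sub_distrib]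
      congr 1
      exact Finset.sum_congr rfl fun i _ => smul_comm _ _ _

/-- Induction on the degree: write `p x = P x x`, reduce `P` by induction and replace the argument
`x` by `φ x`. The induction changes the target from `W` to `g^1 →ₗ[ℂ] W`, so it is run over all
targets in the universe of `L`, which is stable under this change. -/
theorem exists_finType_aux (m : ℕ) (k : ℕ) : ∀ {W : Type u} [AddCommGroup W] [Module ℂ W]
    {p : g.Deg 1 → W}, IsHomogPoly k p → ∃ q ∈ c.finType W, p - q ∈ g.rel m W := by
  induction k with
  | zero =>
    intro W _ _ p ⟨F, hF⟩
    refine ⟨p, ?_, by rw [sub_self]; exact Submodule.zero_mem _⟩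
    have : p = fun _ => F 0 := by
      funext x; rw [hF]; congr 1; exact Subsingleton.elim _ _
    rw [this]; exact finType_const _
  | succ k ih =>
    intro W _ _ p hp
    obtain ⟨P, hP, rfl⟩ := hp.exists_eval
    obtain ⟨Q, hQ, hPQ⟩ := ih hP
    obtain ⟨φ, hφ, hr, -⟩ := c.exists_kuranishi m
    refine ⟨_, finType_bilin LinearMap.id hQ hφ, ?_⟩
    have h1 := rel_bilin LinearMap.id (hP.mem (Nat.zero_le k)) hr
    have h2 := rel_bilin LinearMap.id.flip (finType_le hφ) hPQ
    refine (congrArg (· ∈ g.rel m W) ?_).mp (Submodule.add_mem _ h1 h2)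
    funext x
    simp

theorem exists_finType_univ (m : ℕ) {W : Type u} [AddCommGroup W] [Module ℂ W]
    {p : g.Deg 1 → W} (hp : p ∈ polyGE (g.Deg 1) W 0) :
    ∃ q ∈ c.finType W, p - q ∈ g.rel m W := by
  induction hp using Submodule.span_induction with
  | mem p hp => obtain ⟨k, -, hp⟩ := hp; exact exists_finType_aux m k hp
  | zero => exact ⟨0, Submodule.zero_mem _, by simp⟩
  | add p p' _ _ h h' =>
    obtain ⟨q, hq, h⟩ := h
    obtain ⟨q', hq', h'⟩ := h'
    exact ⟨q + q', Submodule.add_mem _ hq hq', by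
      rw [add_sub_add_comm]; exact Submodule.add_mem _ h h'⟩
  | smul a p _ h =>
    obtain ⟨q, hq, h⟩ := h
    exact ⟨a • q, Submodule.smul_mem _ a hq, by
      rw [← smul_sub]; exact Submodule.smul_mem _ a h⟩

/-- Modulo relations, every polynomial map is a polynomial in the coordinates. -/
theorem exists_finType (m : ℕ) {W : Type*} [AddCommGroup W] [Module ℂ W] [Small.{u} W]
    {p : g.Deg 1 → W} (hp : p ∈ polyGE (g.Deg 1) W 0) :
    ∃ q ∈ c.finType W, p - q ∈ g.rel m W := by
  -- Transport to the universe of `L`; this makes the result available for `W = ℂ`.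
  let S : W ≃ₗ[ℂ] Shrink.{u} W := (Shrink.linearEquiv ℂ W).symm
  obtain ⟨q, hq, h⟩ := exists_finType_univ (c := c) m (polyGE_comp S.toLinearMap hp)
  refine ⟨_, finType_comp S.symm.toLinearMap hq, ?_⟩
  refine (congrArg (· ∈ g.rel m W) ?_).mp (rel_comp S.symm.toLinearMap h)
  funext x
  simp

/-- This finiteness lets `mem_rel_of_dual` recover a map from finitely many scalar components; a
separate relation for each functional would not assemble into one relation in infinite dimension. -/
theorem finType_range {p : g.Deg 1 → W} (hp : p ∈ c.finType W) :
    ∃ S : Submodule ℂ W, FiniteDimensional ℂ S ∧ ∀ x, p x ∈ S := by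
  induction hp using Submodule.span_induction with
  | mem p hp =>
    obtain ⟨f, -, w, rfl⟩ := hp
    exact ⟨Submodule.span ℂ {w}, inferInstance, fun x =>
      Submodule.smul_mem _ _ (Submodule.mem_span_singleton_self w)⟩
  | zero => exact ⟨⊥, inferInstance, fun x => Submodule.zero_mem _⟩
  | add p q _ _ h h' =>
    obtain ⟨S, hS, h⟩ := h
    obtain ⟨S', hS', h'⟩ := h'
    exact ⟨S ⊔ S', inferInstance, fun x => Submodule.add_mem_sup (h x) (h' x)⟩
  | smul a p _ h =>
    obtain ⟨S, hS, h⟩ := h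
    exact ⟨S, hS, fun x => Submodule.smul_mem _ a (h x)⟩

include c in
/-- Relations are detected by linear functionals. -/
theorem mem_rel_of_dual {m : ℕ} {W : Type*} [AddCommGroup W] [Module ℂ W] [Small.{u} W]
    {p : g.Deg 1 → W} (hp : p ∈ polyGE (g.Deg 1) W 0)
    (h : ∀ ψ : Module.Dual ℂ W, (fun x => ψ (p x)) ∈ g.rel m ℂ) : p ∈ g.rel m W := by
  obtain ⟨q, hq, hpq⟩ := exists_finType (c := c) m hp
  have hq' : ∀ ψ : Module.Dual ℂ W, (fun x => ψ (q x)) ∈ g.rel m ℂ := by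
    intro ψ
    refine (congrArg (· ∈ g.rel m ℂ) ?_).mp (Submodule.sub_mem _ (h ψ) (rel_comp ψ hpq))
    funext x
    simp
  suffices q ∈ g.rel m W by
    have := Submodule.add_mem _ hpq this
    rwa [sub_add_cancel] at this
  obtain ⟨S, hS, hqS⟩ := finType_range hq
  -- The coordinates on `S` are extended to functionals on `W` through a projection `P`, so that the
  -- hypothesis on functionals applies to them.
  obtain ⟨P, hP⟩ := S.subtype.exists_leftInverse_of_injective S.ker_subtype
  let b := Module.finBasis ℂ S
  have : q = ∑ i, fun x => LinearMap.toSpanSingleton ℂ W (b i) ((b.coord i ∘ₗ P) (q x)) := by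
    funext x
    have h1 : P (q x) = ⟨q x, hqS x⟩ := LinearMap.congr_fun hP ⟨q x, hqS x⟩
    have h2 := congrArg Subtype.val (b.sum_repr (P (q x)))
    simp only [AddSubmonoidClass.coe_finsetSum, Submodule.coe_smul] at h2
    simp only [Finset.sum_apply, LinearMap.toSpanSingleton_apply, LinearMap.comp_apply,
      Module.Basis.coord_apply]
    rw [h2, h1]
  rw [this]
  exact Submodule.sum_mem _ fun i _ => rel_comp _ (hq' _)

/-- A polynomial map of order `> k` is, modulo relations, a combination of the coordinates with
coefficients of order `≥ k`. -/
theorem exists_division (c : g.Coords n) (m k : ℕ) {p : g.Deg 1 → W}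
    (hp : p ∈ polyGE (g.Deg 1) W (k + 1)) :
    ∃ q : Fin n → g.Deg 1 → W, (∀ i, q i ∈ polyGE (g.Deg 1) W k) ∧
      (p - fun x => ∑ i, c.lam i x • q i x) ∈ g.rel m W := by
  induction hp using Submodule.span_induction with
  | mem p hp =>
    obtain ⟨j, hj, hp⟩ := hp
    obtain ⟨j, rfl⟩ := Nat.exists_eq_add_of_le' (Nat.one_le_of_lt hj)
    obtain ⟨P, hP, rfl⟩ := hp.exists_eval
    obtain ⟨φ, hφ, hr, ψ, hψ, hφψ⟩ := c.exists_kuranishi m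
    -- Modulo relations, `P x x` equals `P x (φ x)`, and `φ x = ∑ lam i x • ψ i x`.
    refine ⟨fun i x => P x (ψ i x), fun i => ?_, ?_⟩
    · have h := polyGE_bilin (LinearMap.id (R := ℂ) (M := g.Deg 1 →ₗ[ℂ] W))
        (hP.mem (Nat.le_of_succ_le_succ hj)) (hψ i)
      rwa [add_zero] at h
    · have h := rel_bilin (LinearMap.id (R := ℂ) (M := g.Deg 1 →ₗ[ℂ] W))
        (hP.mem (Nat.zero_le j)) hr
      refine (congrArg (· ∈ g.rel m W) ?_).mp h
      funext x
      simp [hφψ]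
  | zero => exact ⟨0, fun i => Submodule.zero_mem _, by
      simp only [Pi.zero_apply, smul_zero, Finset.sum_const_zero, zero_sub]
      exact Submodule.neg_mem _ (Submodule.zero_mem _)⟩
  | add p p' _ _ h h' =>
    obtain ⟨q, hq, h⟩ := h
    obtain ⟨q', hq', h'⟩ := h'
    refine ⟨q + q', fun i => Submodule.add_mem _ (hq i) (hq' i), ?_⟩
    refine (congrArg (· ∈ g.rel m W) ?_).mp (Submodule.add_mem _ h h')
    funext x
    simp only [Pi.add_apply, Pi.sub_apply, smul_add, Finset.sum_add_distrib]
    abel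
  | smul a p _ h =>
    obtain ⟨q, hq, h⟩ := h
    refine ⟨a • q, fun i => Submodule.smul_mem _ a (hq i), ?_⟩
    refine (congrArg (· ∈ g.rel m W) ?_).mp (Submodule.smul_mem _ a h)
    funext x
    simp only [Pi.smul_apply, Pi.sub_apply, smul_sub, Finset.smul_sum]
    congr 1
    exact Finset.sum_congr rfl fun i _ => smul_comm _ _ _

end Coords

end PosDGLA

/-! ### The action of `Θ_m` on `R_(m+1)` by derivations -/

/-- One derivative `D` serves all vector fields, so linearity of the action in the vector field can
be checked pointwise. -/
theorem polyAct_exists {V W : Type*} [AddCommGroup V] [Module ℂ V] [AddCommGroup W] [Module ℂ W]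
    {p : V → W} (hp : p ∈ polyGE V W 0) :
    ∃ D : V → V →ₗ[ℂ] W, ∀ u : V → V, polyAct u p = fun x => D x (u x) := by
  obtain ⟨D, -, h⟩ := exists_deriv hp
  exact ⟨D, fun u => funext fun x => (h x (u x)).eq⟩

/-- Evaluation of polynomial functions at a point. -/
noncomputable def PolyRing.eval {V : Type*} [AddCommGroup V] [Module ℂ V] (x : V) :
    PolyRing V →ₐ[ℂ] ℂ :=
  (Pi.evalAlgHom ℂ (fun _ : V => ℂ) x).comp (polySubalgebra V).val

theorem PolyRing.eval_apply {V : Type*} [AddCommGroup V] [Module ℂ V] (x : V) (f : PolyRing V) :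
    PolyRing.eval x f = f.1 x := rfl

namespace PosDGLA

variable {L : Type u} [AddCommGroup L] [Module ℂ L] {g : PosDGLA L}

theorem actFun_add_left (u v : polyMap (g.Deg 1) (g.Deg 1)) (f : PolyRing (g.Deg 1)) :
    actFun (u + v) f = actFun u f + actFun v f := by
  obtain ⟨D, hD⟩ := polyAct_exists f.2
  refine Subtype.ext ?_
  change polyAct _ f.1 = polyAct _ f.1 + polyAct _ f.1
  simp only [hD]
  funext x
  exact map_add (D x) _ _

theorem actFun_smul_left (r : PolyRing (g.Deg 1)) (u : polyMap (g.Deg 1) (g.Deg 1))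
    (f : PolyRing (g.Deg 1)) : actFun (r • u) f = r * actFun u f := by
  obtain ⟨D, hD⟩ := polyAct_exists f.2
  refine Subtype.ext ?_
  change polyAct _ f.1 = r.1 * polyAct _ f.1
  simp only [hD]
  funext x
  exact map_smul (D x) (r.1 x) _

theorem actFun_add (u : polyMap (g.Deg 1) (g.Deg 1)) (f f' : PolyRing (g.Deg 1)) :
    actFun u (f + f') = actFun u f + actFun u f' :=
  Subtype.ext (polyAct_add u.1 f.2 f'.2)

theorem actFun_mul (u : polyMap (g.Deg 1) (g.Deg 1)) (f f' : PolyRing (g.Deg 1)) :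
    actFun u (f * f') = f * actFun u f' + f' * actFun u f := by
  refine Subtype.ext ((polyAct_bilin (LinearMap.mul ℂ ℂ) u.1 f.2 f'.2).trans ?_)
  funext x
  change polyAct u.1 f.1 x * f'.1 x + f.1 x * polyAct u.1 f'.1 x =
    f.1 x * polyAct u.1 f'.1 x + f'.1 x * polyAct u.1 f.1 x
  ring

theorem actFun_lin (u : polyMap (g.Deg 1) (g.Deg 1)) (l : Module.Dual ℂ (g.Deg 1)) :
    (actFun u (PolyRing.lin l)).1 = fun x => l (u.1 x) := polyAct_linear u.1 l

theorem actFun_smul (u : polyMap (g.Deg 1) (g.Deg 1)) (a : ℂ) (f : PolyRing (g.Deg 1)) :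
    actFun u (a • f) = a • actFun u f :=
  Subtype.ext (polyAct_comp (LinearMap.lsmul ℂ ℂ a) u.1 f.2)

theorem Rmk_eq_zero {m : ℕ} {f : PolyRing (g.Deg 1)} : g.Rmk m f = 0 ↔ f.1 ∈ g.rel m ℂ :=
  Ideal.Quotient.eq_zero_iff_mem (I := g.relIdeal m)

theorem resR_Rmk (m : ℕ) (f : PolyRing (g.Deg 1)) : g.resR m (g.Rmk (m + 1) f) = g.Rmk m f := rfl

theorem R_smul_def {m : ℕ} (r : g.R (m + 1)) (s : g.R m) : r • s = g.resR m r * s := rfl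

theorem thetaMk_add {m : ℕ} {p p' : polyMap (g.Deg 1) (g.Deg 1)} (hp : g.IsClosed m p)
    (hp' : g.IsClosed m p') : ∃ h : g.IsClosed m (p + p'),
      thetaMk m p hp + thetaMk m p' hp' = thetaMk m (p + p') h := by
  refine ⟨?_, rfl⟩
  rw [IsClosed, map_add]
  exact Submodule.add_mem _ hp hp'

theorem Rmk_smul_thetaMk {m : ℕ} (r : PolyRing (g.Deg 1)) {p : polyMap (g.Deg 1) (g.Deg 1)}
    (hp : g.IsClosed m p) : ∃ h : g.IsClosed m (r • p),
      g.Rmk m r • thetaMk m p hp = thetaMk m (r • p) h := by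
  refine ⟨?_, rfl⟩
  rw [IsClosed, map_smul]
  exact Submodule.smul_mem _ r hp

variable (g) in
/-- The derivation of `R_(m+1)` with values in `R_m` given by the action of a class in `Θ_m`. -/
noncomputable def actionDerivation (m : ℕ) (θ : g.Theta m) :
    Derivation ℂ (g.R (m + 1)) (g.R m) :=
  Derivation.mk' (R := ℂ)
    { toFun := g.actionPairing m θ
      map_add' := fun r s => by
        obtain ⟨u, hu, rfl⟩ := thetaMk_surj θ
        obtain ⟨f, rfl⟩ := Rmk_surj r
        obtain ⟨f', rfl⟩ := Rmk_surj s
        rw [← map_add, actionPairing_mk, actionPairing_mk, actionPairing_mk, actFun_add, map_add]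
      map_smul' := fun a r => by
        obtain ⟨u, hu, rfl⟩ := thetaMk_surj θ
        obtain ⟨f, rfl⟩ := Rmk_surj r
        rw [← map_smul, actionPairing_mk, actionPairing_mk, actFun_smul, map_smul]
        rfl }
    (fun r s => by
        obtain ⟨u, hu, rfl⟩ := thetaMk_surj θ
        obtain ⟨f, rfl⟩ := Rmk_surj r
        obtain ⟨f', rfl⟩ := Rmk_surj s
        rw [R_smul_def, R_smul_def, resR_Rmk, resR_Rmk, ← map_mul]
        change g.actionPairing m _ _ = _ * g.actionPairing m _ _ + _ * g.actionPairing m _ _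
        rw [actionPairing_mk, actionPairing_mk, actionPairing_mk, actFun_mul, map_add, map_mul,
          map_mul])

variable (g) in
/-- The action of `Θ_m` by derivations, as an `R_m`-linear map. -/
noncomputable def actionMap (m : ℕ) :
    g.Theta m →ₗ[g.R m] Derivation ℂ (g.R (m + 1)) (g.R m) where
  toFun := g.actionDerivation m
  map_add' := fun θ η => by
    obtain ⟨u, hu, rfl⟩ := thetaMk_surj θ
    obtain ⟨v, hv, rfl⟩ := thetaMk_surj η
    refine Derivation.ext fun r => ?_
    obtain ⟨f, rfl⟩ := Rmk_surj r
    obtain ⟨h, e⟩ := thetaMk_add hu hv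
    rw [e]
    change g.actionPairing m _ _ = g.actionPairing m _ _ + g.actionPairing m _ _
    simp only [actionPairing_mk, actFun_add_left, map_add]
  map_smul' := fun r θ => by
    obtain ⟨u, hu, rfl⟩ := thetaMk_surj θ
    obtain ⟨p, rfl⟩ := Rmk_surj r
    refine Derivation.ext fun r => ?_
    obtain ⟨f, rfl⟩ := Rmk_surj r
    obtain ⟨h, e⟩ := Rmk_smul_thetaMk p hu
    rw [e]
    change g.actionPairing m _ _ = g.Rmk m p * g.actionPairing m _ _
    simp only [actionPairing_mk, actFun_smul_left, map_mul]

theorem actionMap_mk {m : ℕ} {u : polyMap (g.Deg 1) (g.Deg 1)} (hu : g.IsClosed m u)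
    (f : PolyRing (g.Deg 1)) :
    g.actionMap m (thetaMk m u hu) (g.Rmk (m + 1) f) = g.Rmk m (actFun u f) :=
  g.actionPairing_mk m u hu f

theorem resR_actionMap {m : ℕ} (θ : g.Theta (m + 1)) (r : g.R (m + 2)) :
    g.resR m (g.actionMap (m + 1) θ r) = g.actionMap m (g.resTheta m θ) (g.resR (m + 1) r) := by
  obtain ⟨u, hu, rfl⟩ := thetaMk_surj θ
  obtain ⟨f, rfl⟩ := Rmk_surj r
  rw [resTheta_mk, actionMap_mk, resR_Rmk, resR_Rmk, actionMap_mk]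

/-! ### Bijectivity of the action and the commutator formula -/

namespace Coords

variable {n : ℕ} (c : g.Coords n)

theorem exists_alg_of_finType {p : g.Deg 1 → ℂ} (hp : p ∈ c.finType ℂ) :
    ∃ f ∈ c.alg, f.1 = p := by
  induction hp using Submodule.span_induction with
  | mem p hp =>
    obtain ⟨f, hf, w, rfl⟩ := hp
    exact ⟨w • f, Subalgebra.smul_mem _ hf w, funext fun x => mul_comm _ _⟩
  | zero => exact ⟨0, zero_mem _, rfl⟩
  | add p q _ _ h h' =>
    obtain ⟨f, hf, rfl⟩ := h
    obtain ⟨f', hf', rfl⟩ := h'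
    exact ⟨f + f', add_mem hf hf', rfl⟩
  | smul a p _ h =>
    obtain ⟨f, hf, rfl⟩ := h
    exact ⟨a • f, Subalgebra.smul_mem _ hf a, rfl⟩

/-- The scalar case of the Kuranishi reduction: the coordinates generate `R_m` as an algebra. -/
theorem exists_alg_Rmk {m : ℕ} (r : g.R m) : ∃ f ∈ c.alg, g.Rmk m f = r := by
  obtain ⟨f, rfl⟩ := Rmk_surj r
  obtain ⟨q, hq, h⟩ := exists_finType (c := c) m f.2
  obtain ⟨f', hf', rfl⟩ := c.exists_alg_of_finType hq
  exact ⟨f', hf', (Rmk_eq.2 h).symm⟩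

/-- Maps that satisfy the Leibniz rule agree if they agree on the coordinates. -/
theorem leibniz_ext {k m : ℕ} (ρ : g.R k →ₐ[ℂ] g.R m) {D E : g.R k →ₗ[ℂ] g.R m}
    (hD : ∀ r s, D (r * s) = ρ r * D s + ρ s * D r)
    (hE : ∀ r s, E (r * s) = ρ r * E s + ρ s * E r)
    (h : ∀ i, D (g.Rmk k (PolyRing.lin (c.lam i))) = E (g.Rmk k (PolyRing.lin (c.lam i))))
    (r : g.R k) : D r = E r := by
  obtain ⟨f, hf, rfl⟩ := c.exists_alg_Rmk r
  have h1 : ∀ F : g.R k →ₗ[ℂ] g.R m, (∀ r s, F (r * s) = ρ r * F s + ρ s * F r) → F 1 = 0 := by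
    intro F hF
    have := hF 1 1
    rw [mul_one, map_one ρ, one_mul] at this
    exact left_eq_add.1 this
  induction hf using Algebra.adjoin_induction with
  | mem f hf => obtain ⟨i, rfl⟩ := hf; exact h i
  | algebraMap a =>
    rw [AlgHom.commutes, Algebra.algebraMap_eq_smul_one, map_smul, map_smul, h1 D hD, h1 E hE]
  | add f f' _ _ h h' => rw [map_add, map_add, map_add, h, h']
  | mul f f' _ _ h h' => rw [map_mul, hD, hE, h, h']

include c

/-- The action of `u` on a linear function `l` is `l ∘ u`. If all of these are relations, so is `u`,
by `mem_rel_of_dual`. -/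
theorem actionMap_injective (m : ℕ) : Function.Injective (g.actionMap m) := by
  rw [injective_iff_map_eq_zero]
  intro θ hθ
  obtain ⟨u, hu, rfl⟩ := thetaMk_surj θ
  have h0 : g.IsClosed m 0 := by
    rw [IsClosed, map_zero]
    exact Submodule.zero_mem _
  have e : (0 : g.Theta m) = thetaMk m 0 h0 := rfl
  rw [e, thetaMk_eq, sub_zero]
  refine mem_rel_of_dual (c := c) u.2 fun l => ?_
  have h : g.actionMap m (thetaMk m u hu) (g.Rmk (m + 1) (PolyRing.lin l)) = 0 := by
    rw [hθ]; rfl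
  rwa [actionMap_mk, Rmk_eq_zero, actFun_lin] at h

theorem exists_sum_smul {W : Type*} [AddCommGroup W] [Module ℂ W] {p : g.Deg 1 → W}
    (hp : p ∈ c.finType W) : ∃ (k : ℕ) (f : Fin k → PolyRing (g.Deg 1)) (w : Fin k → W),
      p = fun x => ∑ i, (f i).1 x • w i := by
  rw [finType, Submodule.mem_span_set'] at hp
  obtain ⟨k, a, q, rfl⟩ := hp
  choose f hf w hw using fun i => (q i).2
  refine ⟨k, f, fun i => a i • w i, ?_⟩
  funext x
  rw [Finset.sum_apply]
  refine Finset.sum_congr rfl fun i _ => ?_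
  rw [Pi.smul_apply, hw, smul_comm]

/-- In `R_(m+1)` a functional `l` equals `∑ l (v i) • f i`, where `φ = ∑ f i • v i`. A derivation
`D` must therefore send it to `∑ l (v i) • D (f i)`, which forces the choice of the vector field. -/
theorem actionMap_surjective (m : ℕ) : Function.Surjective (g.actionMap m) := by
  intro D
  obtain ⟨φ, hφ, hr, -⟩ := c.exists_kuranishi (m + 1)
  obtain ⟨k, f, v, hfv⟩ := exists_sum_smul c hφ
  have hφv : ∀ x, φ x = ∑ i, PolyRing.eval x (f i) • v i := fun x => congrFun hfv x
  obtain ⟨E, hE⟩ : ∃ E : g.R (m + 1) →ₗ[ℂ] g.R m, ∀ r, E r = D r := ⟨D.toLinearMap, fun _ => rfl⟩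
  have hEmul : ∀ r s, E (r * s) = g.resR m r * E s + g.resR m s * E r := fun r s => by
    rw [hE, hE, hE]; exact D.leibniz r s
  choose f' hf' using fun i => Rmk_surj (E (g.Rmk (m + 1) (f i)))
  -- `f' i` represents the image of `f i` under `D`, so `u` is `D` applied to the coefficients of
  -- `φ`.
  let u : polyMap (g.Deg 1) (g.Deg 1) := ⟨fun x => ∑ i, PolyRing.eval x (f' i) • v i, by
    have : (fun x => ∑ i, PolyRing.eval x (f' i) • v i) =
      ∑ i, fun x => (f' i).1 x • v i := by ext x; simp [PolyRing.eval_apply]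
    rw [this]
    exact Submodule.sum_mem _ fun i _ => polyGE_smul (f' i).2 (polyGE_const _)⟩
  have hu : ∀ x, u.1 x = ∑ i, PolyRing.eval x (f' i) • v i := fun x => rfl
  have hlin : ∀ l : Module.Dual ℂ (g.Deg 1), g.Rmk (m + 1) (PolyRing.lin l) =
      g.Rmk (m + 1) (∑ i, l (v i) • f i) := by
    intro l
    rw [Rmk_eq]
    refine (congrArg (· ∈ g.rel (m + 1) ℂ) ?_).mp (rel_comp l hr)
    funext x
    change _ = l x - PolyRing.eval x (∑ i, l (v i) • f i)
    simp only [map_sub, hφv, map_sum, map_smul, smul_eq_mul, mul_comm]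
  have hclosed : g.IsClosed m u := by
    refine mem_rel_of_dual (c := c) (g.covDiff 1 u).2 fun l => ?_
    -- `P` is `l` of the Maurer-Cartan expression of `φ`, and `Q` is its formal derivative, `l (δ u
    -- + [φ, u])`. Since `P` vanishes in `R_(m+1)`, its image `Q` under `D` vanishes in `R_m`.
    let a : Fin k → ℂ := fun i => l (g.d 1 (v i))
    let b : Fin k → Fin k → ℂ := fun i j => l (g.br 1 (v i) (v j))
    have hb : ∀ i j, b i j = b j i := fun i j => congrArg l (br_one_symm _ _)
    let P : PolyRing (g.Deg 1) :=
      ∑ i, a i • f i + (1 / 2 : ℂ) • ∑ i, ∑ j, b i j • (f i * f j)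
    let Q : PolyRing (g.Deg 1) := ∑ i, a i • f' i + ∑ i, ∑ j, b i j • (f i * f' j)
    have hP : g.Rmk (m + 1) P = 0 := by
      rw [Rmk_eq_zero]
      have h1 : (fun x => l (g.curv x)) ∈ g.rel (m + 1) ℂ :=
        mem_rel.2 ⟨0, Submodule.zero_mem _, _, polyGE_const l, (zero_add _).symm⟩
      have h2 := rel_comp (l ∘ₗ g.d 1) hr
      have h3 := rel_comp l (rel_bilin (g.br 1)
        (Submodule.add_mem _ polyGE_id_zero (finType_le hφ)) hr)
      refine (congrArg (· ∈ g.rel (m + 1) ℂ) ?_).mp (Submodule.sub_mem _ h1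
        (Submodule.add_mem _ h2 (Submodule.smul_mem _ (1 / 2 : ℂ) h3)))
      funext x
      have hPx : PolyRing.eval x P = l (g.d 1 (φ x) + (1 / 2 : ℂ) • g.br 1 (φ x) (φ x)) := by
        simp only [P, a, b, hφv, map_add, map_sum, map_smul, map_mul, LinearMap.sum_apply,
          LinearMap.smul_apply, smul_eq_mul, Finset.mul_sum]
        congr 1
        · exact Finset.sum_congr rfl fun i _ => mul_comm _ _
        · rw [Finset.sum_comm]
          refine Finset.sum_congr rfl fun i _ => Finset.sum_congr rfl fun j _ => ?_
          ring
      refine Eq.trans ?_ hPx.symm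
      simp only [Pi.sub_apply, Pi.add_apply, Pi.smul_apply, LinearMap.comp_apply, curv, map_add,
        map_sub, map_smul, LinearMap.add_apply, br_one_symm (φ x) x, smul_eq_mul]
      ring
    have hQ : g.Rmk m Q = E (g.Rmk (m + 1) P) := by
      -- Symmetry of `b` merges the two halves of the Leibniz rule for `f i * f j`; their sum
      -- absorbs the factor `1 / 2`.
      have e1 : ∑ i, ∑ j, b i j • (g.Rmk m (f j) * E (g.Rmk (m + 1) (f i))) =
          ∑ i, ∑ j, b i j • (g.Rmk m (f i) * E (g.Rmk (m + 1) (f j))) := by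
        rw [Finset.sum_comm]
        exact Finset.sum_congr rfl fun i _ => Finset.sum_congr rfl fun j _ => by rw [hb]
      simp only [P, Q, map_add, map_sum, map_smul, map_mul, hEmul, hf', resR_Rmk, smul_add,
        Finset.sum_add_distrib]
      rw [e1, ← add_smul]
      norm_num
    rw [hP, map_zero, Rmk_eq_zero] at hQ
    -- Correction for replacing `φ x` by `x` in `[φ x, u x]`.
    have h4 := rel_comp l (rel_bilin (g.br 1).flip u.2 hr)
    refine (congrArg (· ∈ g.rel m ℂ) ?_).mp (Submodule.add_mem _ hQ (rel_anti h4))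
    funext x
    have hQx : PolyRing.eval x Q = l (g.d 1 (u.1 x) + g.br 1 (φ x) (u.1 x)) := by
      simp only [Q, a, b, hφv, hu, map_add, map_sum, map_smul, map_mul, LinearMap.sum_apply,
        LinearMap.smul_apply, smul_eq_mul, Finset.mul_sum]
      congr 1
      · exact Finset.sum_congr rfl fun i _ => mul_comm _ _
      · rw [Finset.sum_comm]
        refine Finset.sum_congr rfl fun i _ => Finset.sum_congr rfl fun j _ => ?_
        ring
    change PolyRing.eval x Q + l (g.br 1 (x - φ x) (u.1 x)) =
      l (g.d 1 (u.1 x) + g.br 1 x (u.1 x))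
    rw [hQx]
    simp only [map_add, map_sub, LinearMap.sub_apply]
    ring
  refine ⟨thetaMk m u hclosed, Derivation.ext fun r => ?_⟩
  -- It remains to compare on coordinates, where both sides are `∑ lam i (v j) • f' j`.
  refine leibniz_ext c (g.resR m) (D := (g.actionMap m (thetaMk m u hclosed)).toLinearMap)
    (E := D.toLinearMap) (fun r s => Derivation.leibniz _ r s) (fun r s => D.leibniz r s) ?_ r
  intro i
  change g.actionMap m _ _ = D _
  rw [← hE, actionMap_mk, hlin]
  simp only [map_sum, map_smul, ← hf']
  have : actFun u (PolyRing.lin (c.lam i)) = ∑ j, c.lam i (v j) • f' j := by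
    refine Subtype.ext (funext fun x => ?_)
    rw [actFun_lin]
    change _ = PolyRing.eval x (∑ j, c.lam i (v j) • f' j)
    simp only [hu, map_sum, map_smul, smul_eq_mul, mul_comm]
  rw [this]
  simp only [map_sum, map_smul]

theorem actionMap_bijective (m : ℕ) : Function.Bijective (g.actionMap m) :=
  ⟨c.actionMap_injective m, c.actionMap_surjective m⟩

/-- The commutator of the actions of two classes is the action of their bracket. -/
theorem actionMap_commutator (m : ℕ) (θ η : g.Theta (m + 1)) (r : g.R (m + 2)) :
    g.actionMap m (g.resTheta m θ) (g.actionMap (m + 1) η r) -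
      g.actionMap m (g.resTheta m η) (g.actionMap (m + 1) θ r) =
    g.actionMap m (g.bracketPairing m θ η) (g.resR (m + 1) r) := by
  let comp : g.Theta (m + 1) → g.Theta (m + 1) → g.R (m + 2) →ₗ[ℂ] g.R m := fun θ η =>
    (g.actionMap m (g.resTheta m θ)).toLinearMap ∘ₗ (g.actionMap (m + 1) η).toLinearMap
  let ρ : g.R (m + 2) →ₐ[ℂ] g.R m := (g.resR m).comp (g.resR (m + 1))
  have hc : ∀ θ η r, comp θ η r =
    g.actionMap m (g.resTheta m θ) (g.actionMap (m + 1) η r) := fun _ _ _ => rfl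
  -- The failure of a composite of two derivations to satisfy the Leibniz rule is symmetric in `θ`
  -- and `η`, so it cancels in the commutator.
  have hcomp : ∀ θ η r s, comp θ η (r * s) = ρ r * comp θ η s + ρ s * comp θ η r +
      (g.actionMap m (g.resTheta m θ) (g.resR (m + 1) r) *
        g.actionMap m (g.resTheta m η) (g.resR (m + 1) s) +
      g.actionMap m (g.resTheta m θ) (g.resR (m + 1) s) *
        g.actionMap m (g.resTheta m η) (g.resR (m + 1) r)) := by
    intro θ η r s
    rw [hc, hc, hc, Derivation.leibniz, R_smul_def, R_smul_def, map_add, Derivation.leibniz,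
      Derivation.leibniz, R_smul_def, R_smul_def, R_smul_def, R_smul_def, resR_actionMap,
      resR_actionMap]
    simp only [ρ, AlgHom.comp_apply]
    ring
  refine leibniz_ext c ρ (D := comp θ η - comp η θ)
    (E := (g.actionMap m (g.bracketPairing m θ η)).toLinearMap ∘ₗ (g.resR (m + 1)).toLinearMap)
    (fun r s => ?_) (fun r s => ?_) (fun i => ?_) r
  · rw [LinearMap.sub_apply, hcomp, hcomp, LinearMap.sub_apply, LinearMap.sub_apply]
    ring
  · change g.actionMap m _ (g.resR (m + 1) (r * s)) = _
    rw [map_mul, Derivation.leibniz]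
    rfl
  -- On a linear function `l`, acting by `v` and then by `u` gives `l` of the derivative of `v`
  -- along `u`; antisymmetrising gives `l` of the bracket.
  · obtain ⟨u, hu, rfl⟩ := thetaMk_surj θ
    obtain ⟨v, hv, rfl⟩ := thetaMk_surj η
    rw [LinearMap.sub_apply, hc, hc, LinearMap.comp_apply, Derivation.coeFn_coe,
      AlgHom.toLinearMap_apply, bracketPairing_mk, resTheta_mk, resTheta_mk, actionMap_mk,
      actionMap_mk, actionMap_mk, actionMap_mk, resR_Rmk, actionMap_mk, ← map_sub]
    congr 1
    refine Subtype.ext ?_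
    rw [actFun_lin]
    have h : ∀ u v : polyMap (g.Deg 1) (g.Deg 1),
        (actFun u (actFun v (PolyRing.lin (c.lam i)))).1 =
          fun x => c.lam i (polyAct u.1 v.1 x) := fun u v => by
      change polyAct u.1 (actFun v (PolyRing.lin (c.lam i))).1 = _
      rw [actFun_lin, polyAct_comp (c.lam i) u.1 v.2]
    change (actFun u (actFun v (PolyRing.lin (c.lam i)))).1 -
      (actFun v (actFun u (PolyRing.lin (c.lam i)))).1 = _
    rw [h, h]
    funext x
    exact (map_sub (c.lam i) _ _).symm

end Coords

end PosDGLA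

/-! ### The bracket through the faithful action on functions -/

namespace PosDGLA

variable {L : Type u} [AddCommGroup L] [Module ℂ L] {g : PosDGLA L}

theorem complex_smul_theta {m : ℕ} (a : ℂ) (θ : g.Theta m) :
    a • θ = algebraMap ℂ (g.R m) a • θ :=
  (algebraMap_smul (PolyRing (g.Deg 1)) a θ).symm

theorem actionMap_smul {m : ℕ} (a : ℂ) (θ : g.Theta m) (r : g.R (m + 1)) :
    g.actionMap m (a • θ) r = a • g.actionMap m θ r := by
  rw [complex_smul_theta, map_smul, Derivation.smul_apply, algebraMap_smul]

theorem resR_surjective (m : ℕ) : Function.Surjective (g.resR m) := by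
  intro r
  obtain ⟨f, rfl⟩ := Rmk_surj r
  exact ⟨g.Rmk (m + 1) f, rfl⟩

theorem resTheta_bracketPairing (m : ℕ) (θ η : g.Theta (m + 2)) :
    g.resTheta m (g.bracketPairing (m + 1) θ η) =
      g.bracketPairing m (g.resTheta (m + 1) θ) (g.resTheta (m + 1) η) := by
  obtain ⟨u, hu, rfl⟩ := thetaMk_surj θ
  obtain ⟨v, hv, rfl⟩ := thetaMk_surj η
  rw [bracketPairing_mk, resTheta_mk, resTheta_mk, resTheta_mk, bracketPairing_mk]

namespace Coords

variable {n : ℕ} (c : g.Coords n)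

include c in
-- Faithfulness of the action, tested only on restrictions from `R_(m+2)`. This suffices as
-- restriction is surjective, and it matches the right-hand side of `actionMap_commutator`.
theorem theta_ext {m : ℕ} {θ η : g.Theta m}
    (h : ∀ r, g.actionMap m θ (g.resR (m + 1) r) = g.actionMap m η (g.resR (m + 1) r)) :
    θ = η := by
  refine c.actionMap_injective m (Derivation.ext fun r => ?_)
  obtain ⟨r, rfl⟩ := resR_surjective _ r
  exact h r

/-- The bracket pairing as a bilinear map. -/
noncomputable def bracketMap (m : ℕ) :
    g.Theta (m + 1) →ₗ[ℂ] g.Theta (m + 1) →ₗ[ℂ] g.Theta m :=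
  LinearMap.mk₂ ℂ (g.bracketPairing m)
    -- Each identity is checked after acting on functions, where the bracket becomes a commutator.
    (fun θ θ' η => c.theta_ext fun r => by
      simp only [← c.actionMap_commutator, map_add, Derivation.add_apply]; abel)
    (fun a θ η => c.theta_ext fun r => by
      simp only [← c.actionMap_commutator, map_smul, actionMap_smul, Derivation.map_smul,
        smul_sub])
    (fun θ η η' => c.theta_ext fun r => by
      simp only [← c.actionMap_commutator, map_add, Derivation.add_apply]; abel)
    (fun a θ η => c.theta_ext fun r => by
      simp only [← c.actionMap_commutator, map_smul, actionMap_smul, Derivation.map_smul,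
        smul_sub])

theorem bracketMap_apply {m : ℕ} (θ η : g.Theta (m + 1)) :
    c.bracketMap m θ η = g.bracketPairing m θ η := rfl

theorem bracketMap_self {m : ℕ} (θ : g.Theta (m + 1)) : c.bracketMap m θ θ = 0 :=
  c.theta_ext fun r => by
    rw [bracketMap_apply, ← c.actionMap_commutator, sub_self, map_zero]; rfl

end Coords

/-! ### The inverse limits -/

variable (g) in
/-- The projection of the inverse limit to `R_m`. -/
noncomputable def RHat.proj (m : ℕ) : g.RHat →ₐ[ℂ] g.R m :=
  (Pi.evalAlgHom ℂ g.R m).comp g.RHatSubalgebra.val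

/-- The element of the inverse limit given by a compatible family. -/
noncomputable def RHat.mk (f : ∀ m, g.R m) (h : ∀ m, g.resR m (f (m + 1)) = f m) : g.RHat :=
  ⟨f, h⟩

theorem RHat.proj_mk (f : ∀ m, g.R m) (h : ∀ m, g.resR m (f (m + 1)) = f m) (m : ℕ) :
    RHat.proj g m (RHat.mk f h) = f m := rfl

theorem RHat.ext {f f' : g.RHat} (h : ∀ m, RHat.proj g m f = RHat.proj g m f') : f = f' :=
  Subtype.ext (funext h)

theorem RHat.resR_proj (f : g.RHat) (m : ℕ) :
    g.resR m (RHat.proj g (m + 1) f) = RHat.proj g m f := f.2 m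

/-- The element of the inverse limit defined by a polynomial function. -/
noncomputable def RHat.ofPoly : PolyRing (g.Deg 1) →ₐ[ℂ] g.RHat :=
  (AlgHom.pi g.Rmk).codRestrict g.RHatSubalgebra fun _ _ => rfl

theorem RHat.proj_ofPoly (m : ℕ) (p : PolyRing (g.Deg 1)) :
    RHat.proj g m (RHat.ofPoly p) = g.Rmk m p := rfl

theorem ThetaHat_add (u v : g.ThetaHat) (m : ℕ) : (u + v).1 m = u.1 m + v.1 m := rfl

theorem ThetaHat_smul (a : ℂ) (u : g.ThetaHat) (m : ℕ) : (a • u).1 m = a • u.1 m := rfl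

/-- The action of an element of the inverse limit of the `Θ_m` on the inverse limit of the
`R_m`. -/
noncomputable def actionHatLinear (u : g.ThetaHat) : g.RHat →ₗ[ℂ] g.RHat where
  toFun f := RHat.mk (fun m => g.actionMap m (u.1 m) (RHat.proj g (m + 1) f))
    fun m => by rw [resR_actionMap, RHat.resR_proj, u.2 m]
  map_add' f f' := RHat.ext fun m => by
    simp only [RHat.proj_mk, map_add]
  map_smul' a f := RHat.ext fun m => by
    rw [RingHom.id_apply, map_smul, RHat.proj_mk, RHat.proj_mk, map_smul,
      Derivation.map_smul]

theorem proj_actionHatLinear (u : g.ThetaHat) (f : g.RHat) (m : ℕ) :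
    RHat.proj g m (actionHatLinear u f) =
      g.actionMap m (u.1 m) (RHat.proj g (m + 1) f) := rfl

theorem actionHatLinear_mul (u : g.ThetaHat) (f f' : g.RHat) :
    actionHatLinear u (f * f') = f * actionHatLinear u f' + f' * actionHatLinear u f :=
  RHat.ext fun m => by
    rw [map_add (RHat.proj g m), map_mul (RHat.proj g m), map_mul (RHat.proj g m),
      proj_actionHatLinear, proj_actionHatLinear, proj_actionHatLinear,
      map_mul (RHat.proj g (m + 1)), Derivation.leibniz,
      R_smul_def, R_smul_def, RHat.resR_proj, RHat.resR_proj]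

/-- The derivation of the inverse limit of the `R_m` given by an element of the inverse limit of
the `Θ_m`. -/
noncomputable def actionHatDerivation (u : g.ThetaHat) : Derivation ℂ g.RHat g.RHat :=
  Derivation.mk' (actionHatLinear u) (actionHatLinear_mul u)

theorem proj_actionHatDerivation (u : g.ThetaHat) (f : g.RHat) (m : ℕ) :
    RHat.proj g m (actionHatDerivation u f) =
      g.actionMap m (u.1 m) (RHat.proj g (m + 1) f) := rfl

variable (g) in
/-- The action of the inverse limit of the `Θ_m` by derivations of the inverse limit of the
`R_m`. -/
noncomputable def actionHat : g.ThetaHat →ₗ[ℂ] Derivation ℂ g.RHat g.RHat where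
  toFun := actionHatDerivation
  map_add' u v := Derivation.ext fun f => RHat.ext fun m => by
    rw [Derivation.add_apply, map_add (RHat.proj g m), proj_actionHatDerivation,
      proj_actionHatDerivation, proj_actionHatDerivation, ThetaHat_add, map_add,
      Derivation.add_apply]
  map_smul' a u := Derivation.ext fun f => RHat.ext fun m => by
    rw [RingHom.id_apply, Derivation.smul_apply, map_smul (RHat.proj g m),
      proj_actionHatDerivation, proj_actionHatDerivation, ThetaHat_smul, actionMap_smul]

theorem proj_actionHat (u : g.ThetaHat) (f : g.RHat) (m : ℕ) :
    RHat.proj g m (g.actionHat u f) = g.actionMap m (u.1 m) (RHat.proj g (m + 1) f) := rfl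

namespace Coords

variable {n : ℕ} (c : g.Coords n)

/-- The bracket of the inverse limit of the `Θ_m`. -/
noncomputable def bracketHat : g.ThetaHat →ₗ[ℂ] g.ThetaHat →ₗ[ℂ] g.ThetaHat :=
  LinearMap.mk₂ ℂ
    (fun u v => ⟨fun m => c.bracketMap m (u.1 (m + 1)) (v.1 (m + 1)), fun m => by
      change g.resTheta m (g.bracketPairing (m + 1) _ _) = g.bracketPairing m _ _
      rw [resTheta_bracketPairing, u.2, v.2]⟩)
    (fun u u' v => Subtype.ext (funext fun m => by
      change c.bracketMap m ((u + u').1 (m + 1)) (v.1 (m + 1)) = _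
      rw [ThetaHat_add, map_add]; rfl))
    (fun a u v => Subtype.ext (funext fun m => by
      change c.bracketMap m ((a • u).1 (m + 1)) (v.1 (m + 1)) = _
      rw [ThetaHat_smul, map_smul]; rfl))
    (fun u v v' => Subtype.ext (funext fun m => by
      change c.bracketMap m (u.1 (m + 1)) ((v + v').1 (m + 1)) = _
      rw [ThetaHat_add, map_add]; rfl))
    (fun a u v => Subtype.ext (funext fun m => by
      change c.bracketMap m (u.1 (m + 1)) ((a • v).1 (m + 1)) = _
      rw [ThetaHat_smul, map_smul]; rfl))

theorem bracketHat_apply (u v : g.ThetaHat) (m : ℕ) :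
    (c.bracketHat u v).1 m = c.bracketMap m (u.1 (m + 1)) (v.1 (m + 1)) := rfl

theorem bracketHat_self (u : g.ThetaHat) : c.bracketHat u u = 0 :=
  Subtype.ext (funext fun _ => c.bracketMap_self _)

include c in
-- Polynomial functions lift every element of each `R_(m+1)` to the limit, so the action on the
-- limit determines the action at every level.
theorem actionHat_injective : Function.Injective g.actionHat := by
  intro u v h
  refine Subtype.ext (funext fun m => c.actionMap_injective m (Derivation.ext fun r => ?_))
  obtain ⟨p, rfl⟩ := Rmk_surj r
  rw [← RHat.proj_ofPoly, ← proj_actionHat, ← proj_actionHat, h]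

theorem actionHat_bracketHat (u v : g.ThetaHat) :
    g.actionHat (c.bracketHat u v) = ⁅g.actionHat u, g.actionHat v⁆ := by
  refine Derivation.ext fun f => RHat.ext fun m => ?_
  rw [Derivation.commutator_apply, map_sub, proj_actionHat, proj_actionHat, proj_actionHat,
    proj_actionHat, proj_actionHat, bracketHat_apply, bracketMap_apply, ← RHat.resR_proj f (m + 1),
    ← c.actionMap_commutator, u.2, v.2]

/-- The identity holds for commutators of derivations and is pulled back along the injective
`actionHat`. -/
theorem bracketHat_jacobi (u v w : g.ThetaHat) :
    c.bracketHat u (c.bracketHat v w) =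
      c.bracketHat (c.bracketHat u v) w + c.bracketHat v (c.bracketHat u w) := by
  apply c.actionHat_injective
  rw [map_add]
  simp only [actionHat_bracketHat]
  exact leibniz_lie _ _ _

/-! ### Division in the limit and automatic continuity of derivations -/

/-- One step of successive approximation. The error at level `N` is a multiple of the Maurer-Cartan
map, which is a relation at every level, plus a term of order `> N`. Dividing that term by the
coordinates changes the coefficients only in order `≥ N`, so the approximations converge. -/
theorem exists_correction (f : g.RHat) {N : ℕ} {s : Fin n → PolyRing (g.Deg 1)}
    (hs : g.Rmk N (∑ i, PolyRing.lin (c.lam i) * s i) = RHat.proj g N f) :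
    ∃ s' : Fin n → PolyRing (g.Deg 1),
      g.Rmk (N + 1) (∑ i, PolyRing.lin (c.lam i) * s' i) = RHat.proj g (N + 1) f ∧
      ∀ i, (s' i - s i).1 ∈ polyGE (g.Deg 1) ℂ N := by
  obtain ⟨p, hp⟩ := Rmk_surj (RHat.proj g (N + 1) f)
  have h1 : p.1 - (∑ i, PolyRing.lin (c.lam i) * s i).1 ∈ g.rel N ℂ := by
    rw [← Rmk_eq, hs, ← RHat.resR_proj, ← hp, resR_Rmk]
  obtain ⟨e, he, Q, hQ, hpe⟩ := mem_rel.1 h1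
  obtain ⟨q, hq, heq⟩ := c.exists_division (N + 1) N he
  let q' : Fin n → PolyRing (g.Deg 1) := fun i => ⟨q i, polyGE_anti (Nat.zero_le _) (hq i)⟩
  refine ⟨fun i => s i + q' i, ?_, fun i => ?_⟩
  · rw [← hp, eq_comm, Rmk_eq]
    have h2 : (fun x => Q x (g.curv x)) ∈ g.rel (N + 1) ℂ :=
      mem_rel.2 ⟨0, Submodule.zero_mem _, Q, hQ, (zero_add _).symm⟩
    refine (congrArg (· ∈ g.rel (N + 1) ℂ) ?_).mp (Submodule.add_mem _ heq h2)
    funext x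
    have h3 : PolyRing.eval x p - PolyRing.eval x (∑ i, PolyRing.lin (c.lam i) * s i) =
      e x + Q x (g.curv x) := congrFun hpe x
    have h4 : ∀ i, PolyRing.eval x (q' i) = q i x := fun i => rfl
    have h5 : ∀ i, PolyRing.eval x (PolyRing.lin (c.lam i)) = c.lam i x := fun i => rfl
    change e x - ∑ i, c.lam i x • q i x + Q x (g.curv x) = PolyRing.eval x p -
      PolyRing.eval x (∑ i, PolyRing.lin (c.lam i) * (s i + q' i))
    simp only [mul_add, Finset.sum_add_distrib, map_add, map_sum, map_mul, h4, h5,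
      smul_eq_mul] at h3 ⊢
    linear_combination -h3
  · have : s i + q' i - s i = q' i := add_sub_cancel_left _ _
    rw [this]
    exact hq i

theorem proj_eq_zero_of_le {f : g.RHat} {k : ℕ} (h : RHat.proj g k f = 0) {m : ℕ} (hm : m ≤ k) :
    RHat.proj g m f = 0 := by
  induction hm using Nat.decreasingInduction with
  | self => exact h
  | of_succ j _ ih => rw [← RHat.resR_proj, ih, map_zero]

/-- An element of the inverse limit that vanishes in `R_(k+1)` is a combination of the coordinates
with coefficients that vanish in `R_k`. -/
theorem exists_division_hat (f : g.RHat) {k : ℕ} (hf : RHat.proj g (k + 1) f = 0) :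
    ∃ q : Fin n → g.RHat, (∀ i, RHat.proj g k (q i) = 0) ∧
      f = ∑ i, RHat.ofPoly (PolyRing.lin (c.lam i)) * q i := by
  choose! nxt hnxt hnxt' using fun (N : ℕ) (s : Fin n → PolyRing (g.Deg 1))
    (hs : g.Rmk N (∑ i, PolyRing.lin (c.lam i) * s i) = RHat.proj g N f) =>
      c.exists_correction f hs
  -- `S j` holds coefficients valid at level `k + j + 1`. The start `0` is correct because `f`
  -- vanishes in `R_(k+1)`.
  let S : ℕ → Fin n → PolyRing (g.Deg 1) := fun j => Nat.rec 0 (fun j s => nxt (k + j + 1) s) j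
  have hS0 : S 0 = 0 := rfl
  have hS : ∀ j, g.Rmk (k + j + 1) (∑ i, PolyRing.lin (c.lam i) * S j i) =
      RHat.proj g (k + j + 1) f := by
    intro j
    induction j with
    | zero =>
      simp only [hS0, Pi.zero_apply, mul_zero, Finset.sum_const_zero, map_zero]
      exact hf.symm
    | succ j ih => exact hnxt _ _ ih
  have hSs : ∀ j i, (S (j + 1) i - S j i).1 ∈ polyGE (g.Deg 1) ℂ (k + j + 1) :=
    fun j i => hnxt' _ _ (hS j) i
  have hcompat : ∀ i M, g.resR M (g.Rmk (M + 1) (S (M + 1 - k) i)) = g.Rmk M (S (M - k) i) := by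
    intro i M
    rw [resR_Rmk, Rmk_eq]
    rcases lt_or_ge M k with h | h
    · rw [Nat.sub_eq_zero_of_le h, Nat.sub_eq_zero_of_le h.le, sub_self]
      exact Submodule.zero_mem _
    · obtain ⟨j, rfl⟩ := Nat.exists_eq_add_of_le h
      rw [Nat.add_sub_cancel_left, show k + j + 1 - k = j + 1 by omega]
      exact polyGE_le_rel _ (hSs j i)
  -- Passing from `S j` to `S (j + 1)` leaves the classes in `R_(k+j)` unchanged, hence the shift to
  -- `S (M - k)` at level `M`. For `M ≤ k` the truncated subtraction gives `S 0 = 0`, so the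
  -- quotients vanish in `R_k`.
  refine ⟨fun i => RHat.mk (fun M => g.Rmk M (S (M - k) i)) (hcompat i), fun i => ?_, ?_⟩
  · rw [RHat.proj_mk, Nat.sub_self, hS0]; exact map_zero _
  · refine RHat.ext fun M => ?_
    rw [map_sum]
    simp only [map_mul, RHat.proj_ofPoly, RHat.proj_mk]
    simp only [← map_mul]
    rw [← map_sum]
    rcases lt_or_ge M k with h | h
    · rw [proj_eq_zero_of_le hf (by omega), Nat.sub_eq_zero_of_le h.le, hS0]
      simp only [Pi.zero_apply, mul_zero, Finset.sum_const_zero, map_zero]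
    · obtain ⟨j, rfl⟩ := Nat.exists_eq_add_of_le h
      rw [Nat.add_sub_cancel_left, ← RHat.resR_proj, ← hS, resR_Rmk]

include c in
/-- Derivations of the inverse limit are continuous. -/
theorem proj_derivation_eq_zero (D : Derivation ℂ g.RHat g.RHat) (m : ℕ) :
    ∀ f : g.RHat, RHat.proj g (m + 1) f = 0 → RHat.proj g m (D f) = 0 := by
  -- Divide `f` by the coordinates with quotients `q i` vanishing in `R_m`. In the Leibniz expansion
  -- of `D f` the terms with the factor `q i` vanish there, leaving the products of the coordinates
  -- with `D (q i)`.
  have key : ∀ m, (∀ i (q : g.RHat), RHat.proj g m q = 0 →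
      g.Rmk m (PolyRing.lin (c.lam i)) * RHat.proj g m (D q) = 0) →
      ∀ f : g.RHat, RHat.proj g (m + 1) f = 0 → RHat.proj g m (D f) = 0 := by
    intro m h f hf
    obtain ⟨q, hq, rfl⟩ := c.exists_division_hat f hf
    rw [map_sum, map_sum]
    refine Finset.sum_eq_zero fun i _ => ?_
    rw [Derivation.leibniz, smul_eq_mul, smul_eq_mul, map_add, map_mul, map_mul, hq, zero_mul,
      add_zero, RHat.proj_ofPoly, h i _ (hq i)]
  induction m with
  | zero =>
    refine key 0 fun i q _ => ?_
    rw [Rmk_eq_zero.2 (polyGE_le_rel 0 (polyGE_linear (c.lam i))), zero_mul]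
  | succ m ih =>
    refine key (m + 1) fun i q hq => ?_
    have h := ih q hq
    obtain ⟨p, hp⟩ := Rmk_surj (RHat.proj g (m + 1) (D q))
    rw [← RHat.resR_proj, ← hp, resR_Rmk, Rmk_eq_zero] at h
    rw [← hp, ← map_mul, Rmk_eq_zero]
    -- By induction `D q` vanishes in `R_m`; the coordinate has no constant term, so the product
    -- vanishes in `R_(m+1)`.
    exact rel_bilin_one (LinearMap.mul ℂ ℂ) (polyGE_linear (c.lam i)) h

include c in
-- Continuity makes the class of `D f` in `R_m` depend only on the class of `f` in `R_(m+1)`, so `D`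
-- may be computed on arbitrary lifts.
theorem exists_derivation_level (D : Derivation ℂ g.RHat g.RHat) (m : ℕ) :
    ∃ E : Derivation ℂ (g.R (m + 1)) (g.R m),
      ∀ f, E (RHat.proj g (m + 1) f) = RHat.proj g m (D f) := by
  have hsurj : ∀ r : g.R (m + 1), ∃ f, RHat.proj g (m + 1) f = r := fun r => by
    obtain ⟨p, rfl⟩ := Rmk_surj r
    exact ⟨RHat.ofPoly p, rfl⟩
  choose s hs using hsurj
  have hwd : ∀ f, RHat.proj g m (D (s (RHat.proj g (m + 1) f))) = RHat.proj g m (D f) := by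
    intro f
    rw [← sub_eq_zero, ← map_sub, ← map_sub]
    refine c.proj_derivation_eq_zero D m _ ?_
    rw [map_sub, hs, sub_self]
  refine ⟨Derivation.mk' (R := ℂ)
    { toFun := fun r => RHat.proj g m (D (s r))
      map_add' := fun r r' => ?_
      map_smul' := fun a r => ?_ } fun r r' => ?_, hwd⟩
  · conv_lhs => rw [← hs r, ← hs r', ← map_add, hwd, map_add, map_add]
  · conv_lhs => rw [← hs r, ← map_smul, hwd, Derivation.map_smul, map_smul]
    rfl
  · change RHat.proj g m (D (s (r * r'))) =
      r • RHat.proj g m (D (s r')) + r' • RHat.proj g m (D (s r))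
    conv_lhs => rw [← hs r, ← hs r', ← map_mul, hwd, Derivation.leibniz, map_add, smul_eq_mul,
      smul_eq_mul, map_mul, map_mul, ← RHat.resR_proj, ← RHat.resR_proj (s r'), hs, hs]
    rfl

include c in
-- Each level of `D` comes from a class in `Θ_m` by surjectivity of `A_m`. These classes form a
-- compatible family because their actions do and the action is faithful.
theorem actionHat_surjective : Function.Surjective g.actionHat := by
  intro D
  choose E hE using c.exists_derivation_level D
  choose u hu using fun m => c.actionMap_surjective m (E m)
  refine ⟨⟨u, fun m => ?_⟩, Derivation.ext fun f => RHat.ext fun m => ?_⟩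
  · refine c.theta_ext fun r => ?_
    obtain ⟨p, rfl⟩ := Rmk_surj r
    rw [← resR_actionMap, hu, hu, ← RHat.proj_ofPoly, hE, RHat.resR_proj, RHat.resR_proj, hE]
  · rw [proj_actionHat, ← hE]
    exact congrArg (fun F : Derivation ℂ (g.R (m + 1)) (g.R m) => F _) (hu m)

end Coords

end PosDGLA

theorem theorem6p1 {L : Type u} [AddCommGroup L] [Module ℂ L] (g : PosDGLA L)
    (hfin : ∀ i : ℕ, FiniteDimensional ℂ (g.Coh i)) :
    ∃ (A : ∀ m : ℕ, g.Theta m →ₗ[g.R m] Derivation ℂ (g.R (m + 1)) (g.R m))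
      (B : ∀ m : ℕ, g.Theta (m + 1) →ₗ[ℂ] g.Theta (m + 1) →ₗ[ℂ] g.Theta m),
      -- `A` and `B` are given by the action pairing and the bracket pairing
      (∀ (m : ℕ) (u : g.Theta m) (f : g.R (m + 1)), A m u f = g.actionPairing m u f) ∧
      (∀ (m : ℕ) (u v : g.Theta (m + 1)), B m u v = g.bracketPairing m u v) ∧
      (∀ (m : ℕ) (u : g.Theta (m + 1)), B m u u = 0) ∧
      -- (i) compatibility with restriction; bijectivity in the lowest degrees
      (∀ (m : ℕ) (u : g.Theta (m + 1)) (f : g.R (m + 2)),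
        g.resR m (A (m + 1) u f) = A m (g.resTheta m u) (g.resR (m + 1) f)) ∧
      Function.Bijective (A 0) ∧
      Function.Bijective (A 1) ∧
      -- (ii) the commutator of derivations
      (∀ (m : ℕ) (u v : g.Theta (m + 1)) (f : g.R (m + 2)),
        A m (g.resTheta m u) (A (m + 1) v f) - A m (g.resTheta m v) (A (m + 1) u f) =
          A m (B m u v) (g.resR (m + 1) f)) ∧
      -- (iii) the inverse limit
      ∃ (Bhat : g.ThetaHat →ₗ[ℂ] g.ThetaHat →ₗ[ℂ] g.ThetaHat)
        (Ahat : g.ThetaHat →ₗ[ℂ] Derivation ℂ g.RHat g.RHat),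
        (∀ (u v : g.ThetaHat) (m : ℕ),
          (Bhat u v).1 m = B m (u.1 (m + 1)) (v.1 (m + 1))) ∧
        (∀ (u : g.ThetaHat) (f : g.RHat) (m : ℕ),
          (Ahat u f).1 m = A m (u.1 m) (f.1 (m + 1))) ∧
        (∀ u : g.ThetaHat, Bhat u u = 0) ∧
        (∀ u v w : g.ThetaHat,
          Bhat u (Bhat v w) = Bhat (Bhat u v) w + Bhat v (Bhat u w)) ∧
        (∀ u v : g.ThetaHat, Ahat (Bhat u v) = ⁅Ahat u, Ahat v⁆) ∧
        (g.Unobstructed → Function.Bijective Ahat) := by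
  obtain ⟨n, ⟨c⟩⟩ := PosDGLA.exists_coords (hfin 1)
  exact ⟨g.actionMap, c.bracketMap, fun _ _ _ => rfl, fun _ _ _ => rfl,
    fun _ => c.bracketMap_self, fun _ => PosDGLA.resR_actionMap, c.actionMap_bijective 0,
    c.actionMap_bijective 1, c.actionMap_commutator, c.bracketHat, g.actionHat,
    c.bracketHat_apply, PosDGLA.proj_actionHat, c.bracketHat_self, c.bracketHat_jacobi,
    c.actionHat_bracketHat, fun _ => ⟨c.actionHat_injective, c.actionHat_surjective⟩⟩
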